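/- **Setting.** Let $\mathcal X\subseteq\mathbb R^{N_1}$ be nonempty, convex and compact, $c:\mathcal X\to\mathbb R$ convex, $\mathcal Y\subseteq\mathbb R^{N_2}$ a closed, convex, pointed, full-dimensional cone with dual cone $\mathcal Y^*$, and let $\Xi=\{\xi\in\{0,1\}^M: E\xi\le f\}$ with $E\in\mathbb R^{F\times M}$, $f\in\mathbb R^F$. Let $q(\xi)=q_0+Q\xi\in\mathbb R^{N_2}$ and $W(\xi)=W_0+\sum_{j=1}^M\xi_jW_j\in\mathbb R^{L\times N_2}$, and let $T:\mathcal X\to\mathbb R^{L\times M}$, $h:\mathcal X\to\mathbb R^L$ be componentwise convex and lower semicontinuous. The second-stage loss is $$\mathcal Q(x,\xi)=\inf_{y\in\mathcal Y}\{q(\xi)^\top y: W(\xi)y\ge T(x)\xi+h(x)\}.$$ Assume (A1) for every $\xi\in\Xi$ there is $y^+\in\operatorname{int}\mathcal Y$ with $W(\xi)y^+>0$; (A2) $\mathcal Q(x,\xi)$ is finite for all $x\in\mathcal X$, $\xi\in\Xi$. Let $\mathbb P$ be a probability distribution on $\Xi$, let $\hat\xi^{(1)},\hat\xi^{(2)},\dots$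 be i.i.d. with law $\mathbb P$, let $\hat{\mathbb P}_N=\frac1N\sum_{i\le N}\delta_{\hat\xi^{(i)}}$, let $\|\cdot\|$ be a norm on $\mathbb R^M$, and let $d_W$ be the Wasserstein distance $d_W(\mathbb Q,\mathbb Q')=\min_\Pi\sum_{\xi,\xi'\in\Xi}\|\xi-\xi'\|\,\Pi(\xi,\xi')$ over couplings $\Pi$ of $\mathbb Q,\mathbb Q'$. For radii $\varepsilon_N\ge0$ define the optimal value of the distributionally robust (DRO) problem $$v^\star_N=\inf_{x\in\mathcal X}\Big\{c(x)+\sup\{\mathbb E_{\mathbb Q}[\mathcal Q(x,\xi)]:\ \mathbb Q\text{ a distribution on }\Xi,\ d_W(\mathbb Q,\hat{\mathbb P}_N)\le\varepsilon_N\}\Big\}$$ and the optimal value of the true two-stage stochastic problem $v_\infty=\inf_{x\in\mathcal X}\{c(x)+\mathbb E_{\mathbb P}[\mathcal Q(x,\xi)]\}$. The DRO problem has convex hull reformulations $\inf_{x\in\mathcal X,\alpha\ge0}c(x)+\alpha\varepsilon_N+\frac1N\sum_{i\le N}\sup_{z\in\operatorname{cl\,conv}\mathcal Z_i}\{g(x,z)-\alpha\tau\}$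 with mixed-integer conic sets $\mathcal Z_i$. Replacing $\operatorname{cl\,conv}\mathcal Z_i$ by the continuous relaxation $\mathcal Z_i^0$ of $\mathcal Z_i$ gives $$v^0_N=\inf_{x\in\mathcal X,\ \alpha\ge0}\ c(x)+\alpha\varepsilon_N+\frac1N\sum_{i=1}^N\ \sup_{z\in\mathcal Z_i^0}\{g(x,z)-\alpha\tau\}.$$ With $\Xi^0=\{\xi\in[0,1]^M:E\xi\le f\}$, the two representations are: * *Linearized.* Let $\bar\lambda\in\mathbb R^L_+$ be such that $\lambda\le\bar\lambda$ whenever $\lambda\ge0$ and $q(\xi)-W(\xi)^\top\lambda\in\mathcal Y^*$ for some $\xi\in\Xi$. Then $z=(\xi,\lambda,\Lambda,\tau)$, $g(x,z)=\langle T(x),\Lambda\rangle+h(x)^\top\lambda$, and $\mathcal Z_i^0$ is the set of $z\in\Xi^0\times\mathbb R^L_+\times\mathbb R^{L\times M}_+\times\mathbb R_+$ with $\|\xi-\hat\xi^{(i)}\|\le\tau$, $\lambda_l-\bar\lambda_l(1-\xi_j)\le\Lambda_{lj}\le\min\{\lambda_l,\bar\lambda_l\xi_j\}$ for all $l,j$,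 and $q_0+Q\xi-W_0^\top\lambda-\sum_jW_j^\top\Lambda e_j\in\mathcal Y^*$. * *Penalty*, under fixed recourse: (A3) $W(\xi)=W_0$ on $\Xi$ and $T(x)=T_0$ on $\mathcal X$. Let $\rho>0$ be an exact penalty parameter, i.e. for all $x\in\mathcal X$, $\xi\in\Xi$, $\mathcal Q(x,\xi)$ equals $\inf_{y\in\mathcal Y,\,\zeta\in[0,1]^M}\{q(\xi)^\top y+\rho((e-2\xi)^\top\zeta+e^\top\xi):W_0y\ge T_0\zeta+h(x)\}$, where $e$ is the all-ones vector. Then $z=(\xi,\lambda,\mu,\tau)$, $g(x,z)=h(x)^\top\lambda+\rho\,e^\top\xi-e^\top\mu$, and $\mathcal Z_i^0$ is the set of $z\in\Xi^0\times\mathbb R^L_+\times\mathbb R^M_+\times\mathbb R_+$ with $\|\xi-\hat\xi^{(i)}\|\le\tau$, $q_0+Q\xi-W_0^\top\lambda\in\mathcal Y^*$ and $\rho(e-2\xi)+T_0^\top\lambda+\mu\ge0$. In both cases $\mathcal Z_i$ is the same set with $\Xi$ in place of $\Xi^0$. **Theorem.** Suppose $N\varepsilon_N\to0$ as $N\to\infty$.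 Then $v_\infty$ is finite and, almost surely, $\lim_{N\to\infty}v^\star_N=v_\infty$. Moreover, bounds $\bar\lambda$ as above exist, and for every such $\bar\lambda$ the value $v^0_N$ of the linearized representation satisfies $\lim_{N\to\infty}v^0_N=v_\infty=\lim_{N\to\infty}v_N^\star$ almost surely. Under (A3), every sufficiently large $\rho$ is an exact penalty parameter, and for every exact $\rho>0$ the value $v^0_N$ of the penalty representation likewise satisfies $\lim_{N\to\infty}v^0_N=v_\infty=\lim_{N\to\infty}v_N^\star$ almost surely. -/

import Mathlib

open Filter Topology MeasureTheory ProbabilityTheory Matrix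

noncomputable section

/-- Data of a two-stage conic problem with zero-one uncertainty, with first-stage decisions
`x ∈ X ⊆ ℝ^{N₁}`, second-stage decisions `y ∈ Y ⊆ ℝ^{N₂}`, `L` second-stage constraints,
`M` uncertain parameters and an outer description of the support by `F` linear inequalities. -/
structure TwoStageProblem (N₁ N₂ L M F : ℕ) where
  /-- first-stage feasible set -/
  X : Set (Fin N₁ → ℝ)
  X_nonempty : X.Nonempty
  X_convex : Convex ℝ X
  X_compact : IsCompact X
  /-- first-stage cost -/
  c : (Fin N₁ → ℝ) → ℝ
  c_convex : ConvexOn ℝ X c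
  /-- second-stage cone: closed, convex, pointed and full-dimensional -/
  Y : ProperCone ℝ (Fin N₂ → ℝ)
  Y_pointed : ∀ y, y ∈ Y → -y ∈ Y → y = 0
  Y_solid : (interior (Y : Set (Fin N₂ → ℝ))).Nonempty
  /-- `q(ξ) = q₀ + Qmat ξ` -/
  q₀ : Fin N₂ → ℝ
  Qmat : Matrix (Fin N₂) (Fin M) ℝ
  /-- `W(ξ) = W₀ + ∑ j, ξ_j W_j` -/
  W₀ : Matrix (Fin L) (Fin N₂) ℝ
  W : Fin M → Matrix (Fin L) (Fin N₂) ℝ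
  /-- `T` and `h` are componentwise convex and closed (lower semicontinuous) on `X` -/
  T : (Fin N₁ → ℝ) → Matrix (Fin L) (Fin M) ℝ
  T_convex : ∀ l j, ConvexOn ℝ X (fun x => T x l j)
  T_closed : ∀ l j, LowerSemicontinuousOn (fun x => T x l j) X
  h : (Fin N₁ → ℝ) → Fin L → ℝ
  h_convex : ∀ l, ConvexOn ℝ X (fun x => h x l)
  h_closed : ∀ l, LowerSemicontinuousOn (fun x => h x l) X
  /-- outer description `E ξ ≤ f` of the support -/
  E : Matrix (Fin F) (Fin M) ℝ
  f : Fin F → ℝ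
  /-- an arbitrary norm on `ℝ^M`, inducing the metric on the support -/
  nrm : Seminorm ℝ (Fin M → ℝ)
  nrm_definite : ∀ v, nrm v = 0 → v = 0

namespace TwoStageProblem

variable {N₁ N₂ L M F : ℕ} (D : TwoStageProblem N₁ N₂ L M F)

/-- The support `Ξ = {ξ ∈ {0,1}^M : E ξ ≤ f}`. -/
def Xi : Finset (Fin M → ℝ) :=
  (Fintype.piFinset fun _ : Fin M => ({0, 1} : Finset ℝ)).filter fun ξ => ∀ k, (D.E *ᵥ ξ) k ≤ D.f k

/-- The continuous relaxation `{ξ ∈ [0,1]^M : E ξ ≤ f}` of the support. -/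
def XiRelaxed : Set (Fin M → ℝ) :=
  {ξ | (∀ j, 0 ≤ ξ j ∧ ξ j ≤ 1) ∧ ∀ k, (D.E *ᵥ ξ) k ≤ D.f k}

/-- The affine cost vector `q(ξ)`. -/
def qAt (ξ : Fin M → ℝ) : Fin N₂ → ℝ := D.q₀ + D.Qmat *ᵥ ξ

/-- The affine recourse matrix `W(ξ)`. -/
def WAt (ξ : Fin M → ℝ) : Matrix (Fin L) (Fin N₂) ℝ := D.W₀ + ∑ j, ξ j • D.W j

/-- The dual cone `Y*`. -/
def dualCone : Set (Fin N₂ → ℝ) := {w | ∀ y ∈ D.Y, 0 ≤ w ⬝ᵥ y}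

/-- The second-stage loss `Q(x, ξ)`, as an extended real. -/
def loss (x : Fin N₁ → ℝ) (ξ : Fin M → ℝ) : EReal :=
  ⨅ y ∈ {y : Fin N₂ → ℝ | y ∈ D.Y ∧ D.T x *ᵥ ξ + D.h x ≤ D.WAt ξ *ᵥ y},
    ((D.qAt ξ ⬝ᵥ y : ℝ) : EReal)

/-- Complete recourse. -/
def CompleteRecourse : Prop :=
  ∀ ξ ∈ D.Xi, ∃ y ∈ interior (D.Y : Set (Fin N₂ → ℝ)), ∀ l, 0 < (D.WAt ξ *ᵥ y) l

/-- Sufficiently expensive recourse: the loss is a finite number. -/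
def ExpensiveRecourse : Prop :=
  ∀ x ∈ D.X, ∀ ξ ∈ D.Xi, D.loss x ξ ≠ ⊥ ∧ D.loss x ξ ≠ ⊤

/-- Fixed recourse: `W(ξ) = W₀` on the support and `T(x) = T₀` on `X`. -/
def FixedRecourse (T₀ : Matrix (Fin L) (Fin M) ℝ) : Prop :=
  (∀ ξ ∈ D.Xi, D.WAt ξ = D.W₀) ∧ ∀ x ∈ D.X, D.T x = T₀

/-! ### Two-stage stochastic and distributionally robust problems

Distributions on the finite support are weight vectors in the standard simplex `stdSimplex ℝ D.Xi`. -/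

/-- The expectation of the loss `Q(x, ·)` (finite by sufficiently expensive recourse). -/
def expectedLoss (x : Fin N₁ → ℝ) (p : D.Xi → ℝ) : ℝ := ∑ ξ, p ξ * (D.loss x ξ).toReal

/-- Optimal value of the two-stage stochastic problem under the distribution `P`. -/
def stochasticValue (P : D.Xi → ℝ) : EReal :=
  ⨅ x ∈ D.X, ((D.c x + D.expectedLoss x P : ℝ) : EReal)

/-- The empirical distribution `(1/N) ∑ i, δ_{s i}` of a sample. -/
def empirical {N : ℕ} (s : Fin N → D.Xi) : D.Xi → ℝ :=
  fun ξ => (1 / (N : ℝ)) * ∑ i, if s i = ξ then 1 else 0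

/-- Couplings of two distributions on the support. -/
def IsCoupling (p p' : D.Xi → ℝ) (γ : D.Xi → D.Xi → ℝ) : Prop :=
  (∀ ξ ξ', 0 ≤ γ ξ ξ') ∧ (∀ ξ, ∑ ξ', γ ξ ξ' = p ξ) ∧ ∀ ξ', ∑ ξ, γ ξ ξ' = p' ξ'

/-- The Wasserstein distance for the metric `d(ξ, ξ') = ‖ξ - ξ'‖`. -/
def wasserstein (p p' : D.Xi → ℝ) : ℝ :=
  sInf {t | ∃ γ, D.IsCoupling p p' γ ∧
    t = ∑ ξ : D.Xi, ∑ ξ' : D.Xi, D.nrm ((ξ : Fin M → ℝ) - ξ') * γ ξ ξ'}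

/-- The Wasserstein ambiguity set of radius `ε` around the empirical distribution. -/
def ambiguitySet {N : ℕ} (ε : ℝ) (s : Fin N → D.Xi) : Set (D.Xi → ℝ) :=
  {p | p ∈ stdSimplex ℝ D.Xi ∧ D.wasserstein p (D.empirical s) ≤ ε}

/-- Optimal value of the distributionally robust two-stage problem. -/
def droValue {N : ℕ} (ε : ℝ) (s : Fin N → D.Xi) : EReal :=
  ⨅ x ∈ D.X, ((D.c x : EReal) + ⨆ p ∈ D.ambiguitySet ε s, (D.expectedLoss x p : EReal))

/-! ### The convex hull reformulation over a given family of sets -/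

/-- The optimal value of
`inf_{x ∈ X, α ≥ 0} c(x) + α ε + (1/N) ∑ i, sup_{z ∈ S i} (g x z - α τ(z))`, that is, of the convex
hull reformulation in which the `i`-th inner maximization ranges over `S i`. -/
def reformValue {V : Type*} (g : (Fin N₁ → ℝ) → V → ℝ) (τ : V → ℝ) {N : ℕ} (ε : ℝ)
    (S : Fin N → Set V) : EReal :=
  ⨅ x ∈ D.X, ⨅ α ∈ Set.Ici (0 : ℝ), (((D.c x + α * ε : ℝ) : EReal) +
    ((1 / (N : ℝ) : ℝ) : EReal) * ∑ i, ⨆ z ∈ S i, ((g x z - α * τ z : ℝ) : EReal))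

/-! ### Linearized representation -/

/-- `lamBar` bounds all dual variables: `0 ≤ lamBar`, and every `λ ≥ 0` with
`q(ξ) - W(ξ)ᵀ λ ∈ Y*` for some `ξ` in the support satisfies `λ ≤ lamBar`. -/
def IsDualBound (lamBar : Fin L → ℝ) : Prop :=
  0 ≤ lamBar ∧ ∀ ξ ∈ D.Xi, ∀ lam : Fin L → ℝ, 0 ≤ lam →
    D.qAt ξ - (D.WAt ξ)ᵀ *ᵥ lam ∈ D.dualCone → lam ≤ lamBar

/-- The linearized set in the variables `(ξ, λ, Λ, τ)` with `ξ` ranging over `S`: for `S = Ξ` it is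
the mixed-integer conic set `𝒵_i`, for `S = XiRelaxed` it is its continuous relaxation. -/
def linearizedSet (S : Set (Fin M → ℝ)) (lamBar : Fin L → ℝ) (ξhat : Fin M → ℝ) :
    Set ((Fin M → ℝ) × (Fin L → ℝ) × Matrix (Fin L) (Fin M) ℝ × ℝ) :=
  {z | match z with
    | (ξ, lam, Lam, τ) =>
      ξ ∈ S ∧ 0 ≤ lam ∧ (∀ l j, 0 ≤ Lam l j) ∧ 0 ≤ τ ∧ D.nrm (ξ - ξhat) ≤ τ ∧
      (∀ l j, 0 ≤ Lam l j - lam l + lamBar l * (1 - ξ j)) ∧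
      (∀ l j, 0 ≤ lam l - Lam l j) ∧
      (∀ l j, 0 ≤ lamBar l * ξ j - Lam l j) ∧
      D.q₀ + D.Qmat *ᵥ ξ - D.W₀ᵀ *ᵥ lam - ∑ j, (D.W j)ᵀ *ᵥ (fun l => Lam l j) ∈ D.dualCone}

/-- The objective `⟨T(x), Λ⟩ + h(x)ᵀ λ`. -/
def linearizedObjective (x : Fin N₁ → ℝ)
    (z : (Fin M → ℝ) × (Fin L → ℝ) × Matrix (Fin L) (Fin M) ℝ × ℝ) : ℝ :=
  (∑ l, ∑ j, D.T x l j * z.2.2.1 l j) + D.h x ⬝ᵥ z.2.1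

/-- Optimal value of the convex hull reformulation with each hull replaced by the continuous
relaxation of the linearized set. -/
def linearizedRelaxedValue (lamBar : Fin L → ℝ) {N : ℕ} (ε : ℝ) (s : Fin N → D.Xi) : EReal :=
  D.reformValue D.linearizedObjective (fun z => z.2.2.2) ε
    fun i => D.linearizedSet D.XiRelaxed lamBar (s i)

/-! ### Penalty representation (under fixed recourse) -/

/-- The penalized loss `Q^ρ(x, ξ)`. -/
def penaltyLoss (T₀ : Matrix (Fin L) (Fin M) ℝ) (ρ : ℝ) (x : Fin N₁ → ℝ) (ξ : Fin M → ℝ) :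
    EReal :=
  ⨅ yz ∈ {yz : (Fin N₂ → ℝ) × (Fin M → ℝ) | yz.1 ∈ D.Y ∧ (∀ j, 0 ≤ yz.2 j ∧ yz.2 j ≤ 1) ∧
      T₀ *ᵥ yz.2 + D.h x ≤ D.W₀ *ᵥ yz.1},
    ((D.qAt ξ ⬝ᵥ yz.1 + ρ * (∑ j, (1 - 2 * ξ j) * yz.2 j + ∑ j, ξ j) : ℝ) : EReal)

/-- `ρ` is an exact penalty parameter: `Q^ρ = Q` on `X × Ξ`. -/
def IsExactPenalty (T₀ : Matrix (Fin L) (Fin M) ℝ) (ρ : ℝ) : Prop :=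
  ∀ x ∈ D.X, ∀ ξ ∈ D.Xi, D.penaltyLoss T₀ ρ x ξ = D.loss x ξ

/-- The penalty set in the variables `(ξ, λ, μ, τ)` with `ξ` ranging over `S`: for `S = Ξ` it is the
mixed-integer conic set `𝒵_i`, for `S = XiRelaxed` it is its continuous relaxation. -/
def penaltySet (S : Set (Fin M → ℝ)) (T₀ : Matrix (Fin L) (Fin M) ℝ) (ρ : ℝ)
    (ξhat : Fin M → ℝ) : Set ((Fin M → ℝ) × (Fin L → ℝ) × (Fin M → ℝ) × ℝ) :=
  {z | match z with
    | (ξ, lam, mu, τ) =>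
      ξ ∈ S ∧ 0 ≤ lam ∧ 0 ≤ mu ∧ 0 ≤ τ ∧ D.nrm (ξ - ξhat) ≤ τ ∧
      D.q₀ + D.Qmat *ᵥ ξ - D.W₀ᵀ *ᵥ lam ∈ D.dualCone ∧
      ∀ j, 0 ≤ ρ * (1 - 2 * ξ j) + (T₀ᵀ *ᵥ lam) j + mu j}

/-- The objective `h(x)ᵀ λ + ρ eᵀ ξ - eᵀ μ`. -/
def penaltyObjective (ρ : ℝ) (x : Fin N₁ → ℝ)
    (z : (Fin M → ℝ) × (Fin L → ℝ) × (Fin M → ℝ) × ℝ) : ℝ :=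
  D.h x ⬝ᵥ z.2.1 + ρ * ∑ j, z.1 j - ∑ j, z.2.2.1 j

/-- Optimal value of the convex hull reformulation with each hull replaced by the continuous
relaxation of the penalty set. -/
def penaltyRelaxedValue (T₀ : Matrix (Fin L) (Fin M) ℝ) (ρ : ℝ) {N : ℕ} (ε : ℝ)
    (s : Fin N → D.Xi) : EReal :=
  D.reformValue (D.penaltyObjective ρ) (fun z => z.2.2.2) ε
    fun i => D.penaltySet D.XiRelaxed T₀ ρ (s i)

end TwoStageProblem

end

/-!
Conic duality under complete recourse writes the second-stage loss `Q(x, ξ)` as an attained maximum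
over dual variables, and the dual problem bounds `c(x) + Q(x, ξ)` below by a convex function of `x`
on the bounded set `X`, hence by a constant `C`. If a distribution `p` has weights `p ξ ≥ θ P ξ`
for some `θ < 1`, the value of the stochastic problem under `p` is therefore at least
`(1 - θ) C + θ v(P)`. This holds for every `p` close to `P` once `θ < 1` is fixed, so the value is
lower semicontinuous in the distribution.

The robust value and both relaxed values dominate the value under the empirical distribution, which
converges to `P` almost surely by the strong law of large numbers; this gives the lower bound. For
the upper bound fix `x` and `δ > 0`. Some transport price `α`, independent of the sample, makes the
objective at `x` at most `c(x) + α ε_N` plus the empirical mean of `Q(x, ξ) + δ`, and `α ε_N` tends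
to `0`. For the robust problem `α` is a Lipschitz constant of `Q(x, ·)` on the finite set `Ξ`. For a
relaxation such an `α` exists by compactness: the points `(ξ, λ, …)` whose transport cost vanishes
have `ξ = ξhat ∈ {0, 1}^M`, and there the relaxed objective is at most `Q(x, ξhat)` by weak duality.
-/

theorem nonneg_of_forall_le_mul {a r : ℝ} (h : ∀ t ≥ 0, r ≤ t * a) : 0 ≤ a := by
  by_contra! ha
  have hbot : Tendsto (fun t : ℝ => t * a) atTop atBot :=
    tendsto_id.atTop_mul_const_of_neg ha
  obtain ⟨t, htr, ht⟩ := ((hbot.eventually_lt_atBot r).and (eventually_ge_atTop 0)).exists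
  exact (h t ht).not_gt htr

section LagrangeMultiplier

variable {E ι : Type*} [AddCommGroup E] [Module ℝ E] {C : Set E} {φ : E → ℝ}
  {G : E → ι → ℝ}

theorem convex_setOf_exists_le_and_le (hφ : ConvexOn ℝ C φ) (hG : ConcaveOn ℝ C G) :
    Convex ℝ {p : (ι → ℝ) × ℝ | ∃ u ∈ C, p.1 ≤ G u ∧ φ u ≤ p.2} := by
  rintro p ⟨u, hu, hpG, hpφ⟩ p' ⟨u', hu', hpG', hpφ'⟩ a b ha hb hab
  refine ⟨a • u + b • u', hφ.1 hu hu' ha hb hab, le_trans ?_ (hG.2 hu hu' ha hb hab),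
    (hφ.2 hu hu' ha hb hab).trans ?_⟩
  · exact add_le_add (smul_le_smul_of_nonneg_left hpG ha) (smul_le_smul_of_nonneg_left hpG' hb)
  · exact add_le_add (smul_le_smul_of_nonneg_left hpφ ha) (smul_le_smul_of_nonneg_left hpφ' hb)

theorem interior_Ici_zero_prod_Iic [Finite ι] (v : ℝ) :
    interior (Set.Ici (0 : ι → ℝ) ×ˢ Set.Iic v) = {p | (∀ i, 0 < p.1 i) ∧ p.2 < v} := by
  ext p
  rw [← Set.pi_univ_Ici, interior_prod_eq, interior_pi_set Set.finite_univ]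
  simp

variable [Fintype ι]

theorem exists_dotProduct_add_mul_eq (f : (ι → ℝ) × ℝ →ₗ[ℝ] ℝ) :
    ∃ (a : ι → ℝ) (b : ℝ), ∀ w r, f (w, r) = a ⬝ᵥ w + b * r := by
  classical
  obtain ⟨a, ha⟩ := (dotProductEquiv ℝ ι).surjective (f ∘ₗ LinearMap.inl ℝ (ι → ℝ) ℝ)
  refine ⟨a, f (0, 1), fun w r => ?_⟩
  have haw : a ⬝ᵥ w = f (w, 0) := LinearMap.congr_fun ha w
  calc f (w, r) = f ((w, 0) + r • (0, 1)) := by simp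
    _ = a ⬝ᵥ w + f (0, 1) * r := by rw [map_add, map_smul, haw, smul_eq_mul, mul_comm]

theorem exists_separating_hyperplane (hφ : ConvexOn ℝ C φ) (hG : ConcaveOn ℝ C G) {v : ℝ}
    (hv : ∀ u ∈ C, 0 ≤ G u → v ≤ φ u) (hC : C.Nonempty) :
    ∃ (a : ι → ℝ) (b s : ℝ), (a ≠ 0 ∨ b ≠ 0) ∧ (∀ w ≥ 0, ∀ r ≤ v, a ⬝ᵥ w + b * r ≤ s) ∧
      ∀ u ∈ C, s ≤ a ⬝ᵥ G u + b * φ u := by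
  have hdisj : Disjoint (interior (Set.Ici (0 : ι → ℝ) ×ˢ Set.Iic v))
      {p : (ι → ℝ) × ℝ | ∃ u ∈ C, p.1 ≤ G u ∧ φ u ≤ p.2} := by
    rw [interior_Ici_zero_prod_Iic, Set.disjoint_left]
    rintro ⟨w, r⟩ ⟨hw, hr⟩ ⟨u, hu, hwG, hφr⟩
    have hvφ : v ≤ φ u := hv u hu fun i => (hw i).le.trans (hwG i)
    exact hr.not_ge (hvφ.trans hφr)
  have hint : (interior (Set.Ici (0 : ι → ℝ) ×ˢ Set.Iic v)).Nonempty := by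
    rw [interior_Ici_zero_prod_Iic]
    exact ⟨(1, v - 1), fun _ => one_pos, sub_one_lt v⟩
  obtain ⟨u₀, hu₀⟩ := hC
  obtain ⟨f, s, hf, hle, hge⟩ := geometric_hahn_banach_of_nonempty_interior
    ((convex_Ici 0).prod (convex_Iic v)) (convex_setOf_exists_le_and_le hφ hG) hdisj hint
    ⟨(G u₀, φ u₀), u₀, hu₀, le_rfl, le_rfl⟩
  obtain ⟨a, b, hab⟩ := exists_dotProduct_add_mul_eq f.toLinearMap
  replace hab : ∀ w r, f (w, r) = a ⬝ᵥ w + b * r := hab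
  refine ⟨a, b, s, ?_, fun w hw r hr => hab w r ▸ hle (w, r) ⟨hw, hr⟩,
    fun u hu => hab (G u) (φ u) ▸ hge (G u, φ u) ⟨u, hu, le_rfl, le_rfl⟩⟩
  contrapose! hf
  exact ContinuousLinearMap.ext fun p => (hab p.1 p.2).trans (by simp [hf.1, hf.2])

theorem exists_lagrange_multiplier (hφ : ConvexOn ℝ C φ) (hG : ConcaveOn ℝ C G) {v : ℝ}
    (hv : ∀ u ∈ C, 0 ≤ G u → v ≤ φ u) {u₀ : E} (hu₀ : u₀ ∈ C) (hslater : ∀ i, 0 < G u₀ i) :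
    ∃ lam : ι → ℝ, 0 ≤ lam ∧ ∀ u ∈ C, v ≤ φ u - lam ⬝ᵥ G u := by
  classical
  obtain ⟨a, b, s, hne, hle, hge⟩ := exists_separating_hyperplane hφ hG hv ⟨u₀, hu₀⟩
  have hbv : b * v ≤ s := by simpa using hle 0 le_rfl v le_rfl
  have ha : a ≤ 0 := fun i => by
    refine neg_nonneg.1 (nonneg_of_forall_le_mul (r := b * v - s) fun t ht => ?_)
    have := hle (Pi.single i t) (by simpa using ht) v le_rfl
    rw [dotProduct_single] at this
    linarith
  have hb : 0 ≤ b := nonneg_of_forall_le_mul (r := b * v - s) fun t ht => by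
    have := hle 0 le_rfl (v - t) (sub_le_self v ht)
    rw [dotProduct_zero] at this
    linarith
  have hb0 : b ≠ 0 := by
    rintro rfl
    have hsum : ∑ i, -a i * G u₀ i ≤ 0 := by
      have hs₀ := hge u₀ hu₀
      simp only [zero_mul, add_zero, dotProduct] at hbv hs₀
      simpa using hbv.trans hs₀
    obtain ⟨i, hi⟩ := Function.ne_iff.1 (hne.resolve_right (not_not.2 rfl))
    refine hsum.not_gt (Finset.sum_pos' (fun j _ => ?_) ⟨i, Finset.mem_univ i, ?_⟩)
    · exact mul_nonneg (neg_nonneg.2 (ha j)) (hslater j).le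
    · exact mul_pos (neg_pos.2 ((ha i).lt_of_ne hi)) (hslater i)
  have hbpos : 0 < b := hb.lt_of_ne' hb0
  refine ⟨-(b⁻¹ • a), neg_nonneg.2 (smul_nonpos_of_nonneg_of_nonpos (inv_nonneg.2 hb) ha),
    fun u hu => ?_⟩
  have hbu : b * v ≤ b * (φ u + b⁻¹ * (a ⬝ᵥ G u)) := by
    rw [mul_add, mul_inv_cancel_left₀ hb0]
    linarith [hge u hu]
  simpa using le_of_mul_le_mul_left hbu hbpos

end LagrangeMultiplier

section ConicDuality

variable {E ι : Type*} [AddCommGroup E] [Module ℝ E] {Y : PointedCone ℝ E} {A : E →ₗ[ℝ] ι → ℝ}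

theorem exists_forall_lt_of_exists_forall_pos [Finite ι] (hA : ∃ y ∈ Y, ∀ i, 0 < A y i)
    (b : ι → ℝ) : ∃ y ∈ Y, ∀ i, b i < A y i := by
  obtain ⟨y, hy, hpos⟩ := hA
  obtain ⟨t, ht⟩ := Finite.exists_le fun i => b i / A y i
  refine ⟨(max t 0 + 1) • y, Y.smul_mem (by positivity) hy, fun i => ?_⟩
  have hlt : b i / A y i < max t 0 + 1 := ((ht i).trans (le_max_left t 0)).trans_lt (lt_add_one _)
  simpa using (div_lt_iff₀ (hpos i)).1 hlt

theorem le_div_of_forall_dotProduct_le [Fintype ι] {q : E →ₗ[ℝ] ℝ} {lam : ι → ℝ}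
    (hlam : 0 ≤ lam) (hdual : ∀ y ∈ Y, lam ⬝ᵥ A y ≤ q y) {y : E} (hy : y ∈ Y)
    (hpos : ∀ i, 0 < A y i) (i : ι) : lam i ≤ q y / A y i := by
  refine (le_div_iff₀ (hpos i)).2 (le_trans ?_ (hdual y hy))
  exact Finset.single_le_sum (f := fun i => lam i * A y i)
    (fun k _ => mul_nonneg (hlam k) (hpos k).le) (Finset.mem_univ i)

theorem exists_conic_dual_solution [Fintype ι] {Z : Type*} [AddCommGroup Z] [Module ℝ Z]
    {q : E →ₗ[ℝ] ℝ} {B : Set Z} {ψ : Z → ℝ} {H : Z → ι → ℝ} (hψ : ConvexOn ℝ B ψ)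
    (hH : ConvexOn ℝ B H) {v : ℝ}
    (hv : ∀ y ∈ Y, ∀ z ∈ B, H z ≤ A y → v ≤ q y + ψ z) (hB : B.Nonempty)
    (hA : ∃ y ∈ Y, ∀ i, 0 < A y i) :
    ∃ lam : ι → ℝ, 0 ≤ lam ∧ (∀ y ∈ Y, lam ⬝ᵥ A y ≤ q y) ∧
      ∀ z ∈ B, v ≤ ψ z + lam ⬝ᵥ H z := by
  obtain ⟨z₀, hz₀⟩ := hB
  obtain ⟨y₀, hy₀, hlt⟩ := exists_forall_lt_of_exists_forall_pos hA (H z₀)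
  have hconv : Convex ℝ ((Y : Set E) ×ˢ B) := Y.convex.prod hψ.1
  have hcost : ConvexOn ℝ ((Y : Set E) ×ˢ B) fun p => q p.1 + ψ p.2 :=
    ((q ∘ₗ LinearMap.fst ℝ E Z).convexOn hconv).add
      ((hψ.comp_linearMap (LinearMap.snd ℝ E Z)).subset (fun p hp => hp.2) hconv)
  have hslack : ConcaveOn ℝ ((Y : Set E) ×ˢ B) fun p => A p.1 - H p.2 :=
    ((A ∘ₗ LinearMap.fst ℝ E Z).concaveOn hconv).sub
      ((hH.comp_linearMap (LinearMap.snd ℝ E Z)).subset (fun p hp => hp.2) hconv)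
  obtain ⟨lam, hlam, hle⟩ := exists_lagrange_multiplier hcost hslack
    (fun p hp hG => hv p.1 hp.1 p.2 hp.2 (sub_nonneg.1 hG)) (u₀ := (y₀, z₀)) ⟨hy₀, hz₀⟩
    fun i => sub_pos.2 (hlt i)
  refine ⟨lam, hlam, fun y hy => sub_nonneg.1 ?_, fun z hz => ?_⟩
  · refine nonneg_of_forall_le_mul (r := v - (ψ z₀ + lam ⬝ᵥ H z₀)) fun t ht => ?_
    have := hle (t • y, z₀) ⟨Y.smul_mem ht hy, hz₀⟩
    simp only [map_smul, dotProduct_sub, dotProduct_smul, smul_eq_mul] at this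
    linarith
  · have := hle (0, z) ⟨Y.zero_mem, hz⟩
    simp only [map_zero, dotProduct_sub, dotProduct_zero] at this
    linarith

end ConicDuality

theorem bddBelow_image_of_convexOn_of_mem_nhds {E : Type*} [SeminormedAddCommGroup E]
    [NormedSpace ℝ E] {s : Set E} {f : E → ℝ} (hf : ConvexOn ℝ s f) (hs : Bornology.IsBounded s)
    {x₀ : E} (hx₀ : s ∈ 𝓝 x₀) (hcont : ContinuousAt f x₀) : BddBelow (f '' s) := by
  obtain ⟨δ, hδ, hball⟩ := Metric.mem_nhds_iff.1
    (inter_mem hx₀ (hcont.eventually (Iio_mem_nhds (lt_add_one (f x₀)))))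
  obtain ⟨R, hR, hsR⟩ := hs.subset_ball_lt 0 x₀
  obtain ⟨t, ht, htR⟩ : ∃ t : ℝ, 0 < t ∧ t * R = δ :=
    ⟨δ / R, div_pos hδ hR, div_mul_cancel₀ δ hR.ne'⟩
  refine ⟨f x₀ - t⁻¹, ?_⟩
  rintro _ ⟨x, hx, rfl⟩
  -- `y` is the reflection of `x` through `x₀`, shrunk so as to stay where `f < f x₀ + 1`.
  set y := x₀ - t • (x - x₀) with hy
  have hyball : y ∈ Metric.ball x₀ δ := by
    have hxR : ‖x - x₀‖ < R := by simpa [dist_eq_norm] using hsR hx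
    calc dist y x₀ = t * ‖x - x₀‖ := by
          rw [hy, dist_eq_norm, sub_sub_cancel_left, norm_neg, norm_smul, Real.norm_of_nonneg ht.le]
      _ < t * R := mul_lt_mul_of_pos_left hxR ht
      _ = δ := htR
  obtain ⟨hys, hfy⟩ := hball hyball
  have hcomb : (1 / (1 + t)) • y + (t / (1 + t)) • x = x₀ := by
    have : 1 + t ≠ 0 := by positivity
    rw [hy]
    match_scalars <;> field_simp <;> ring
  have hconv := (convexOn_iff_div.1 hf).2 hys hx zero_le_one ht.le (by positivity)
  rw [hcomb, smul_eq_mul, smul_eq_mul, one_div_mul_eq_div, div_mul_eq_mul_div, ← add_div,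
    le_div_iff₀ (by positivity)] at hconv
  replace hfy : f y < f x₀ + 1 := hfy
  refine le_of_mul_le_mul_left ?_ ht
  rw [mul_sub, mul_inv_cancel₀ ht.ne']
  linarith

theorem bddBelow_image_of_convexOn_of_isBounded {E : Type*} [NormedAddCommGroup E]
    [NormedSpace ℝ E] [FiniteDimensional ℝ E] {s : Set E} {f : E → ℝ} (hf : ConvexOn ℝ s f)
    (hs : Bornology.IsBounded s) : BddBelow (f '' s) := by
  obtain rfl | hne := s.eq_empty_or_nonempty
  · simp
  obtain ⟨_, a, ha, rfl⟩ := hne.intrinsicInterior hf.1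
  -- Inside the direction of its affine span, `s` is a neighbourhood of the origin.
  have : Nonempty (affineSpan ℝ s) := ⟨a⟩
  let e : (affineSpan ℝ s).direction →ᵃ[ℝ] affineSpan ℝ s :=
    (AffineEquiv.vaddConst ℝ a).toAffineMap
  have he : Isometry e := (IsometryEquiv.vaddConst a).isometry
  have hsurj : Function.Surjective e := (AffineEquiv.vaddConst ℝ a).surjective
  let ψ : (affineSpan ℝ s).direction →ᵃ[ℝ] E := (affineSpan ℝ s).subtype.comp e
  have hψ : Isometry ψ := isometry_subtype_coe.comp he
  have hnhds : ψ ⁻¹' s ∈ 𝓝 0 := by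
    have he0 : e 0 = a := zero_vadd _ a
    exact he.continuous.continuousAt.preimage_mem_nhds
      (he0.symm ▸ mem_interior_iff_mem_nhds.1 ha)
  have hconv : ConvexOn ℝ (ψ ⁻¹' s) (f ∘ ψ) := hf.comp_affineMap ψ
  have hcont : ContinuousAt (f ∘ ψ) 0 := hconv.continuousOn_interior.continuousAt
    (interior_mem_nhds.2 hnhds)
  have himage : ψ '' (ψ ⁻¹' s) = s := by
    refine Set.image_preimage_eq_of_subset fun x hx => ?_
    obtain ⟨v, hv⟩ := hsurj ⟨x, subset_affineSpan ℝ s hx⟩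
    exact ⟨v, congrArg Subtype.val hv⟩
  rw [← himage, ← Set.image_comp]
  exact bddBelow_image_of_convexOn_of_mem_nhds hconv (hψ.antilipschitz.isBounded_preimage hs)
    hnhds hcont

section PenaltySlope

variable {V : Type*} [TopologicalSpace V] {K : Set V} {g d : V → ℝ} {b : ℝ}

theorem exists_penalty_slope (hK : IsCompact K) (hg : Continuous g) (hd : Continuous d)
    (hd0 : 0 ≤ d) (hb : ∀ z ∈ K, d z = 0 → g z < b) :
    ∃ α ≥ 0, ∀ z ∈ K, g z - α * d z < b := by
  have hopen : ∀ n : ℕ, IsOpen {z | g z - n * d z < b} := fun n =>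
    isOpen_lt (by fun_prop) continuous_const
  have hmono : Monotone fun n : ℕ => {z | g z - n * d z < b} := fun m n hmn z hz =>
    (sub_le_sub_left (mul_le_mul_of_nonneg_right (Nat.cast_le.2 hmn) (hd0 z)) _).trans_lt hz
  have hcover : K ⊆ ⋃ n : ℕ, {z | g z - n * d z < b} := by
    intro z hz
    obtain hdz | hdz := (hd0 z).eq_or_lt'
    · exact Set.mem_iUnion.2 ⟨0, by simpa using hb z hz hdz⟩
    · obtain ⟨n, hn⟩ := exists_nat_gt ((g z - b) / d z)
      exact Set.mem_iUnion.2 ⟨n, sub_lt_comm.1 ((div_lt_iff₀ hdz).1 hn)⟩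
  obtain ⟨n, hn⟩ := hK.elim_directed_cover _ hopen hcover hmono.directed_le
  exact ⟨n, n.cast_nonneg, hn⟩

theorem exists_penalty_slope_of_dominated {W : Type*} {S : Set W} {f τ : W → ℝ}
    (hK : IsCompact K) (hg : Continuous g) (hd : Continuous d) (hd0 : 0 ≤ d)
    (hdom : ∀ w ∈ S, ∃ z ∈ K, f w ≤ g z ∧ d z ≤ τ w) (hb : ∀ z ∈ K, d z = 0 → g z < b) :
    ∃ α ≥ 0, ∀ w ∈ S, f w - α * τ w < b := by
  obtain ⟨α, hα, hlt⟩ := exists_penalty_slope hK hg hd hd0 hb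
  refine ⟨α, hα, fun w hw => ?_⟩
  obtain ⟨z, hz, hgz, hdz⟩ := hdom w hw
  exact (sub_le_sub hgz (mul_le_mul_of_nonneg_left hdz hα)).trans_lt (hlt z hz)

end PenaltySlope

theorem convexOn_dotProduct {E ι : Type*} [AddCommGroup E] [Module ℝ E] [Fintype ι] {s : Set E}
    {a : ι → ℝ} {f : E → ι → ℝ} (ha : 0 ≤ a) (hf : ConvexOn ℝ s f) :
    ConvexOn ℝ s fun x => a ⬝ᵥ f x := by
  refine ⟨hf.1, fun x hx y hy t u ht hu htu => ?_⟩
  simpa using dotProduct_le_dotProduct_of_nonneg_left (hf.2 hx hy ht hu htu) ha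

theorem convexOn_of_forall_apply {E ι : Type*} [AddCommGroup E] [Module ℝ E] {s : Set E}
    (hs : Convex ℝ s) {f : E → ι → ℝ} (hf : ∀ i, ConvexOn ℝ s fun x => f x i) : ConvexOn ℝ s f :=
  ⟨hs, fun _ hx _ hy _ _ ht hu htu i => (hf i).2 hx hy ht hu htu⟩

section UnitBox

variable {ι : Type*} [Fintype ι] {a mu ζ : ι → ℝ}

theorem neg_sum_le_dotProduct_of_mem_Icc (hζ : ζ ∈ Set.Icc 0 1) (hmu : 0 ≤ mu) (h : 0 ≤ a + mu) :
    -∑ j, mu j ≤ a ⬝ᵥ ζ := by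
  calc -∑ j, mu j ≤ -(mu ⬝ᵥ ζ) :=
        neg_le_neg (Finset.sum_le_sum fun j _ => mul_le_of_le_one_right (hmu j) (hζ.2 j))
    _ ≤ a ⬝ᵥ ζ := by
        rw [neg_le_iff_add_nonneg, ← add_dotProduct]
        exact dotProduct_nonneg_of_nonneg h hζ.1

theorem dotProduct_eq_neg_sum_negPart (h0 : ∀ j, 0 < a j → ζ j = 0) (h1 : ∀ j, a j < 0 → ζ j = 1) :
    a ⬝ᵥ ζ = -∑ j, a⁻ j := by
  rw [dotProduct, ← Finset.sum_neg_distrib]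
  refine Finset.sum_congr rfl fun j _ => ?_
  rw [Pi.negPart_apply]
  rcases lt_trichotomy (a j) 0 with h | h | h
  · rw [h1 j h, negPart_of_nonpos h.le, mul_one, neg_neg]
  · rw [h, zero_mul, negPart_zero, neg_zero]
  · rw [h0 j h, negPart_of_nonneg h.le, mul_zero, neg_zero]

theorem exists_dotProduct_eq_neg_sum_negPart (a : ι → ℝ) :
    ∃ ζ ∈ Set.Icc (0 : ι → ℝ) 1, a ⬝ᵥ ζ = -∑ j, a⁻ j := by
  classical
  refine ⟨fun j => if a j < 0 then 1 else 0, ⟨fun j => ?_, fun j => ?_⟩,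
    dotProduct_eq_neg_sum_negPart (fun j hj => if_neg hj.not_gt) fun j hj => if_pos hj⟩ <;>
  · dsimp only
    split_ifs <;> simp

end UnitBox

theorem ereal_coe_sum {ι : Type*} (s : Finset ι) (f : ι → ℝ) :
    ((∑ i ∈ s, f i : ℝ) : EReal) = ∑ i ∈ s, (f i : EReal) :=
  map_sum (⟨⟨Real.toEReal, EReal.coe_zero⟩, EReal.coe_add⟩ : ℝ →+ EReal) f s

theorem exists_lt_one_lt_convexCombination {a v : ℝ} (h : a < v) (C : ℝ) :
    ∃ θ ∈ Set.Ioo (0 : ℝ) 1, a < (1 - θ) * C + θ * v := by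
  have hlim : Tendsto (fun θ : ℝ => (1 - θ) * C + θ * v) (𝓝[<] 1) (𝓝 v) := by
    have : Continuous fun θ : ℝ => (1 - θ) * C + θ * v := by fun_prop
    simpa using this.continuousWithinAt (s := Set.Iio 1) (x := 1) |>.tendsto
  obtain ⟨θ, hθ, haθ⟩ :=
    (Filter.Eventually.and (Ioo_mem_nhdsLT zero_lt_one) (hlim.eventually_const_lt h)).exists
  exact ⟨θ, hθ, haθ⟩

theorem eventually_mul_le_of_mem_stdSimplex {ι : Type*} [Fintype ι] {P : ι → ℝ} {θ : ℝ}
    (hP : P ∈ stdSimplex ℝ ι) (hθ : θ < 1) :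
    ∀ᶠ p in 𝓝[stdSimplex ℝ ι] P, ∀ i, θ * P i ≤ p i := by
  refine eventually_all.2 fun i => ?_
  obtain hPi | hPi := (hP.1 i).eq_or_lt'
  · filter_upwards [self_mem_nhdsWithin] with p hp
    simpa [hPi] using hp.1 i
  · have hlt : θ * P i < P i := mul_lt_of_lt_one_left hPi hθ
    have hev : ∀ᶠ p : ι → ℝ in 𝓝 P, θ * P i < p i :=
      (continuous_apply i).continuousAt.eventually_const_lt hlt
    exact (hev.filter_mono nhdsWithin_le_nhds).mono fun p => le_of_lt

theorem lowerSemicontinuousOn_iInf_sum_mul {ι α : Type*} [Fintype ι] {S : Set α} {Φ : α → ι → ℝ}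
    {C : ℝ} (hC : ∀ x ∈ S, ∀ i, C ≤ Φ x i) :
    LowerSemicontinuousOn (fun p : ι → ℝ => ⨅ x ∈ S, ((∑ i, p i * Φ x i : ℝ) : EReal))
      (stdSimplex ℝ ι) := by
  intro P hP y hy
  obtain ⟨v, hyv, hv⟩ := EReal.lt_iff_exists_real_btwn.1 hy
  obtain ⟨a, hya, hav⟩ := EReal.lt_iff_exists_real_btwn.1 hyv
  obtain ⟨θ, ⟨hθ0, hθ1⟩, haθ⟩ :=
    exists_lt_one_lt_convexCombination (EReal.coe_lt_coe_iff.1 hav) C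
  filter_upwards [eventually_mul_le_of_mem_stdSimplex hP hθ1, self_mem_nhdsWithin] with p hpP hp
  refine hya.trans_le (le_iInf₂ fun x hx => EReal.coe_le_coe_iff.2 (haθ.le.trans ?_))
  have hvx : v ≤ ∑ i, P i * Φ x i :=
    EReal.coe_le_coe_iff.1 (hv.le.trans (iInf₂_le x hx))
  calc (1 - θ) * C + θ * v
      ≤ (1 - θ) * C + θ * ∑ i, P i * Φ x i := by gcongr
    _ = ∑ i, (p i * C + θ * P i * (Φ x i - C)) := by
        simp only [mul_sub, mul_assoc, Finset.sum_add_distrib, Finset.sum_sub_distrib,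
          ← Finset.mul_sum, ← Finset.sum_mul, hP.2, hp.2]
        ring
    _ ≤ ∑ i, (p i * C + p i * (Φ x i - C)) := by
        gcongr with i
        · exact sub_nonneg.2 (hC x hx i)
        · exact hpP i
    _ = ∑ i, p i * Φ x i := by simp only [← mul_add, add_sub_cancel]

theorem ae_tendsto_frequency {Ω α : Type*} [MeasurableSpace Ω] [MeasurableSpace α] {μ : Measure Ω}
    [IsFiniteMeasure μ] {X : ℕ → Ω → α} (hindep : Pairwise fun i j => X i ⟂ᵢ[μ] X j)
    (hident : ∀ i, IdentDistrib (X i) (X 0) μ μ) {s : Set α} (hs : MeasurableSet s) :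
    ∀ᵐ ω ∂μ, Tendsto (fun n : ℕ => (∑ i ∈ Finset.range n, s.indicator 1 (X i ω)) / (n : ℝ)) atTop
      (𝓝 (μ.real (X 0 ⁻¹' s))) := by
  have hind : Measurable (s.indicator (1 : α → ℝ)) := measurable_one.indicator hs
  have hpre : NullMeasurableSet (X 0 ⁻¹' s) μ :=
    (hident 0).aemeasurable_fst.nullMeasurableSet_preimage hs
  have hcomp : s.indicator 1 ∘ X 0 = (X 0 ⁻¹' s).indicator (1 : Ω → ℝ) := rfl
  have hmean : μ[s.indicator 1 ∘ X 0] = μ.real (X 0 ⁻¹' s) := by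
    rw [hcomp, integral_indicator₀ hpre]
    simp
  rw [← hmean]
  refine strong_law_ae_real (fun i => s.indicator 1 ∘ X i) ?_
    (fun i j hij => (hindep hij).comp hind hind) fun i => (hident i).comp hind
  rw [hcomp]
  exact (integrable_const (1 : ℝ)).indicator₀ hpre

theorem tendsto_zero_of_natCast_mul {ε : ℕ → ℝ}
    (h : Tendsto (fun N : ℕ => (N : ℝ) * ε N) atTop (𝓝 0)) : Tendsto ε atTop (𝓝 0) := by
  have hmul := tendsto_inv_atTop_nhds_zero_nat (𝕜 := ℝ) |>.mul h
  rw [mul_zero] at hmul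
  refine hmul.congr' ?_
  filter_upwards [eventually_ne_atTop 0] with N hN
  exact inv_mul_cancel_left₀ (Nat.cast_ne_zero.2 hN) (ε N)

namespace TwoStageProblem

variable {N₁ N₂ L M F : ℕ} {D : TwoStageProblem N₁ N₂ L M F}

section SecondStage

variable {x : Fin N₁ → ℝ} {ξ : Fin M → ℝ}

/-! ### Duality and stability of the second-stage problem -/

theorem mem_Xi : ξ ∈ D.Xi ↔ (∀ j, ξ j = 0 ∨ ξ j = 1) ∧ ∀ k, (D.E *ᵥ ξ) k ≤ D.f k := by
  simp only [Xi, Finset.mem_filter, Fintype.mem_piFinset, Finset.mem_insert, Finset.mem_singleton]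

theorem mem_XiRelaxed_of_mem_Xi (hξ : ξ ∈ D.Xi) : ξ ∈ D.XiRelaxed := by
  refine ⟨fun j => ?_, (mem_Xi.1 hξ).2⟩
  rcases (mem_Xi.1 hξ).1 j with h | h <;> simp [h]

theorem sub_mem_dualCone_iff {q : Fin N₂ → ℝ} {A : Matrix (Fin L) (Fin N₂) ℝ} {lam : Fin L → ℝ} :
    q - Aᵀ *ᵥ lam ∈ D.dualCone ↔ ∀ y ∈ D.Y, lam ⬝ᵥ A *ᵥ y ≤ q ⬝ᵥ y := by
  simp only [dualCone, Set.mem_ofPred_eq, sub_dotProduct, mulVec_transpose, dotProduct_mulVec,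
    sub_nonneg]

theorem coe_toReal_loss (hA2 : D.ExpensiveRecourse) (hx : x ∈ D.X) (hξ : ξ ∈ D.Xi) :
    ((D.loss x ξ).toReal : EReal) = D.loss x ξ :=
  EReal.coe_toReal (hA2 x hx ξ hξ).2 (hA2 x hx ξ hξ).1

theorem loss_le {y : Fin N₂ → ℝ} (hy : y ∈ D.Y) (h : D.T x *ᵥ ξ + D.h x ≤ D.WAt ξ *ᵥ y) :
    D.loss x ξ ≤ (D.qAt ξ ⬝ᵥ y : ℝ) :=
  iInf₂_le y ⟨hy, h⟩

theorem dual_le_loss {lam : Fin L → ℝ} (hlam : 0 ≤ lam)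
    (hdual : D.qAt ξ - (D.WAt ξ)ᵀ *ᵥ lam ∈ D.dualCone) :
    ((lam ⬝ᵥ (D.T x *ᵥ ξ + D.h x) : ℝ) : EReal) ≤ D.loss x ξ :=
  le_iInf₂ fun y hy => EReal.coe_le_coe_iff.2 <|
    (dotProduct_le_dotProduct_of_nonneg_left hy.2 hlam).trans (sub_mem_dualCone_iff.1 hdual y hy.1)

theorem CompleteRecourse.exists_pos (hA1 : D.CompleteRecourse) (hξ : ξ ∈ D.Xi) :
    ∃ y ∈ D.Y, ∀ l, 0 < (D.WAt ξ *ᵥ y) l := by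
  obtain ⟨y, hy, hpos⟩ := hA1 ξ hξ
  exact ⟨y, interior_subset hy, hpos⟩

theorem exists_dual_optimal (hA1 : D.CompleteRecourse) (hA2 : D.ExpensiveRecourse) (hx : x ∈ D.X)
    (hξ : ξ ∈ D.Xi) :
    ∃ lam : Fin L → ℝ, 0 ≤ lam ∧ D.qAt ξ - (D.WAt ξ)ᵀ *ᵥ lam ∈ D.dualCone ∧
      (D.loss x ξ).toReal ≤ lam ⬝ᵥ (D.T x *ᵥ ξ + D.h x) := by
  obtain ⟨lam, hlam, hdual, hval⟩ := exists_conic_dual_solution (Y := D.Y.toPointedCone)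
    (A := (D.WAt ξ).mulVecLin) (q := dotProductEquiv ℝ _ (D.qAt ξ)) (B := {(0 : ℝ)}) (ψ := 0)
    (H := fun _ => D.T x *ᵥ ξ + D.h x) (convexOn_const 0 (convex_singleton 0))
    (convexOn_const _ (convex_singleton 0)) (v := (D.loss x ξ).toReal)
    (fun y hy _ _ hle => by
      rw [← EReal.coe_le_coe_iff, coe_toReal_loss hA2 hx hξ]
      simpa using loss_le hy hle)
    (Set.singleton_nonempty 0) (hA1.exists_pos hξ)
  exact ⟨lam, hlam, sub_mem_dualCone_iff.2 hdual, by simpa using hval 0 rfl⟩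

theorem exists_isDualBound (hA1 : D.CompleteRecourse) : ∃ lamBar, D.IsDualBound lamBar := by
  choose y hy hpos using fun ξ : D.Xi => hA1.exists_pos ξ.2
  choose B hB using fun l => Finite.exists_le fun ξ : D.Xi =>
    D.qAt ξ ⬝ᵥ y ξ / (D.WAt ξ *ᵥ y ξ) l
  refine ⟨B ⊔ 0, le_sup_right, fun ξ hξ lam hlam hdual l => le_sup_of_le_left ?_⟩
  exact (le_div_of_forall_dotProduct_le (Y := D.Y.toPointedCone) (A := (D.WAt ξ).mulVecLin)
    (q := dotProductEquiv ℝ _ (D.qAt ξ)) hlam (sub_mem_dualCone_iff.1 hdual) (hy ⟨ξ, hξ⟩)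
    (hpos ⟨ξ, hξ⟩) l).trans (hB l ⟨ξ, hξ⟩)

theorem convexOn_constraint (hξ : 0 ≤ ξ) : ConvexOn ℝ D.X fun x => D.T x *ᵥ ξ + D.h x := by
  have hT : ∀ l, ConvexOn ℝ D.X fun x => (D.T x *ᵥ ξ) l := fun l =>
    (convexOn_dotProduct hξ (convexOn_of_forall_apply D.X_convex (D.T_convex l))).congr
      fun x _ => dotProduct_comm _ _
  exact convexOn_of_forall_apply D.X_convex fun l => (hT l).add (D.h_convex l)

theorem exists_le_cost_add_loss (hA1 : D.CompleteRecourse) (hA2 : D.ExpensiveRecourse) :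
    ∃ C, ∀ x ∈ D.X, ∀ ξ : D.Xi, C ≤ D.c x + (D.loss x ξ).toReal := by
  obtain ⟨x₀, hx₀⟩ := D.X_nonempty
  choose lam hlam hdual _ using fun ξ : D.Xi => exists_dual_optimal hA1 hA2 hx₀ ξ.2
  have hbdd : ∀ ξ : D.Xi, ∃ C, ∀ x ∈ D.X, C ≤ D.c x + (D.loss x ξ).toReal := fun ξ => by
    have hξ : (0 : Fin M → ℝ) ≤ ξ := fun j => ((mem_XiRelaxed_of_mem_Xi ξ.2).1 j).1
    obtain ⟨C, hC⟩ := bddBelow_image_of_convexOn_of_isBounded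
      (D.c_convex.add (convexOn_dotProduct (hlam ξ) (convexOn_constraint hξ)))
      D.X_compact.isBounded
    refine ⟨C, fun x hx => (hC ⟨x, hx, rfl⟩).trans (add_le_add_right ?_ _)⟩
    rw [← EReal.coe_le_coe_iff, coe_toReal_loss hA2 hx ξ.2]
    exact dual_le_loss (hlam ξ) (hdual ξ)
  choose C hC using hbdd
  obtain ⟨C₀, hC₀⟩ := Finite.exists_ge C
  exact ⟨C₀, fun x hx ξ => (hC₀ ξ).trans (hC ξ x hx)⟩

theorem cost_add_expectedLoss_eq_sum {p : D.Xi → ℝ} (hp : p ∈ stdSimplex ℝ D.Xi) :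
    D.c x + D.expectedLoss x p = ∑ ξ, p ξ * (D.c x + (D.loss x ξ).toReal) := by
  simp only [mul_add, Finset.sum_add_distrib, ← Finset.sum_mul, hp.2, one_mul, expectedLoss]

theorem lowerSemicontinuousOn_stochasticValue (hA1 : D.CompleteRecourse)
    (hA2 : D.ExpensiveRecourse) :
    LowerSemicontinuousOn D.stochasticValue (stdSimplex ℝ D.Xi) := by
  obtain ⟨C, hC⟩ := exists_le_cost_add_loss hA1 hA2
  refine fun P hP => LowerSemicontinuousWithinAt.congr_of_eventuallyEq
    (lowerSemicontinuousOn_iInf_sum_mul hC P hP) hP ?_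
  filter_upwards [self_mem_nhdsWithin] with p hp
  simp only [stochasticValue, cost_add_expectedLoss_eq_sum hp]

theorem exists_stochasticValue_eq_coe (hA1 : D.CompleteRecourse) (hA2 : D.ExpensiveRecourse)
    {P : D.Xi → ℝ} (hP : P ∈ stdSimplex ℝ D.Xi) : ∃ v : ℝ, D.stochasticValue P = v := by
  obtain ⟨C, hC⟩ := exists_le_cost_add_loss hA1 hA2
  obtain ⟨x₀, hx₀⟩ := D.X_nonempty
  have hlow : (C : EReal) ≤ D.stochasticValue P := le_iInf₂ fun x hx => by
    rw [EReal.coe_le_coe_iff, cost_add_expectedLoss_eq_sum hP]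
    calc C = ∑ ξ, P ξ * C := by rw [← Finset.sum_mul, hP.2, one_mul]
      _ ≤ _ := Finset.sum_le_sum fun ξ _ => mul_le_mul_of_nonneg_left (hC x hx ξ) (hP.1 ξ)
  refine ⟨(D.stochasticValue P).toReal, (EReal.coe_toReal ?_ ?_).symm⟩
  · exact ((iInf₂_le x₀ hx₀).trans_lt (EReal.coe_lt_top _)).ne
  · exact ((EReal.bot_lt_coe C).trans_le hlow).ne'

theorem tendsto_stochasticValue_of_le_of_le (hA1 : D.CompleteRecourse) (hA2 : D.ExpensiveRecourse)
    {P : D.Xi → ℝ} (hP : P ∈ stdSimplex ℝ D.Xi) {ι : Type*} {l : Filter ι} {p : ι → D.Xi → ℝ}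
    (hp : ∀ᶠ i in l, p i ∈ stdSimplex ℝ D.Xi) (hpP : Tendsto p l (𝓝 P)) {ε : ι → ℝ}
    (hε : Tendsto ε l (𝓝 0)) {V : ι → EReal} (hlow : ∀ᶠ i in l, D.stochasticValue (p i) ≤ V i)
    (hup : ∀ x ∈ D.X, ∀ δ > 0, ∃ K : ℝ, ∀ᶠ i in l,
      V i ≤ (D.c x + K * ε i + (D.expectedLoss x (p i) + δ) : ℝ)) :
    Tendsto V l (𝓝 (D.stochasticValue P)) := by
  refine tendsto_order.2 ⟨fun a ha => ?_, fun a ha => ?_⟩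
  · have hlsc := (tendsto_nhdsWithin_iff.2 ⟨hpP, hp⟩).eventually
      (lowerSemicontinuousOn_stochasticValue hA1 hA2 P hP a ha)
    filter_upwards [hlsc, hlow] with i hi hVi using hi.trans_le hVi
  · simp only [stochasticValue, iInf_lt_iff] at ha
    obtain ⟨x, hx, hxa⟩ := ha
    obtain ⟨b, hxb, hba⟩ := EReal.lt_iff_exists_real_btwn.1 hxa
    set r := D.c x + D.expectedLoss x P
    have hrb : r < b := EReal.coe_lt_coe_iff.1 hxb
    obtain ⟨K, hK⟩ := hup x hx ((b - r) / 2) (half_pos (sub_pos.2 hrb))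
    have hexp : Tendsto (fun i => D.expectedLoss x (p i)) l (𝓝 (D.expectedLoss x P)) :=
      tendsto_finsetSum _ fun ξ _ => (tendsto_pi_nhds.1 hpP ξ).mul_const _
    have hlim : Tendsto (fun i => D.c x + K * ε i + (D.expectedLoss x (p i) + (b - r) / 2)) l
        (𝓝 (D.c x + K * 0 + (D.expectedLoss x P + (b - r) / 2))) :=
      ((hε.const_mul K).const_add _).add (hexp.add_const _)
    filter_upwards [hK, hlim.eventually_lt_const (u := b) (by linarith)] with i hVi hi
    exact (hVi.trans (EReal.coe_le_coe_iff.2 hi.le)).trans_lt hba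

end SecondStage

section RobustAndRelaxedValues

variable {x : Fin N₁ → ℝ}

/-! ### The distributionally robust problem -/

theorem empirical_mem_stdSimplex {N : ℕ} (hN : N ≠ 0) (s : Fin N → D.Xi) :
    D.empirical s ∈ stdSimplex ℝ D.Xi := by
  refine ⟨fun ξ => mul_nonneg (by positivity) (Finset.sum_nonneg fun i _ => ?_), ?_⟩
  · split_ifs <;> norm_num
  · simp only [empirical, ← Finset.mul_sum]
    rw [Finset.sum_comm]
    simp [hN]

theorem expectedLoss_empirical {N : ℕ} (s : Fin N → D.Xi) (x : Fin N₁ → ℝ) :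
    D.expectedLoss x (D.empirical s) = (1 / (N : ℝ)) * ∑ i, (D.loss x (s i)).toReal := by
  simp only [expectedLoss, empirical, mul_assoc, ← Finset.mul_sum, Finset.sum_mul]
  rw [Finset.sum_comm]
  simp

theorem isCoupling_diagonal {p : D.Xi → ℝ} (hp : 0 ≤ p) :
    D.IsCoupling p p fun ξ ξ' => if ξ = ξ' then p ξ else 0 := by
  refine ⟨fun ξ ξ' => ?_, fun ξ => by simp, fun ξ' => by simp⟩
  dsimp only
  split_ifs
  exacts [hp ξ, le_rfl]

theorem isCoupling_mul {p p' : D.Xi → ℝ} (hp : p ∈ stdSimplex ℝ D.Xi)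
    (hp' : p' ∈ stdSimplex ℝ D.Xi) : D.IsCoupling p p' fun ξ ξ' => p ξ * p' ξ' := by
  refine ⟨fun ξ ξ' => mul_nonneg (hp.1 ξ) (hp'.1 ξ'), fun ξ => ?_, fun ξ' => ?_⟩
  · rw [← Finset.mul_sum, hp'.2, mul_one]
  · rw [← Finset.sum_mul, hp.2, one_mul]

theorem wasserstein_self_nonpos {p : D.Xi → ℝ} (hp : 0 ≤ p) : D.wasserstein p p ≤ 0 := by
  refine csInf_le ⟨0, ?_⟩ ⟨_, isCoupling_diagonal hp, by simp⟩
  rintro _ ⟨γ, hγ, rfl⟩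
  exact Finset.sum_nonneg fun ξ _ => Finset.sum_nonneg fun ξ' _ =>
    mul_nonneg (apply_nonneg D.nrm _) (hγ.1 ξ ξ')

theorem exists_sub_le_mul_nrm (f : D.Xi → ℝ) :
    ∃ K ≥ 0, ∀ ξ ξ' : D.Xi, f ξ - f ξ' ≤ K * D.nrm ((ξ : Fin M → ℝ) - ξ') := by
  obtain ⟨K, hK⟩ := Finite.exists_le fun w : D.Xi × D.Xi =>
    (f w.1 - f w.2) / D.nrm ((w.1 : Fin M → ℝ) - w.2)
  refine ⟨max K 0, le_max_right K 0, fun ξ ξ' => ?_⟩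
  obtain h | h := (apply_nonneg D.nrm ((ξ : Fin M → ℝ) - ξ')).eq_or_lt
  · obtain rfl : ξ = ξ' := Subtype.ext (sub_eq_zero.1 (D.nrm_definite _ h.symm))
    simp
  · exact (div_le_iff₀ h).1 ((hK (ξ, ξ')).trans (le_max_left K 0))

theorem sum_mul_sub_sum_mul_le_mul_wasserstein {f : D.Xi → ℝ} {K : ℝ} (hK : 0 ≤ K)
    (hf : ∀ ξ ξ' : D.Xi, f ξ - f ξ' ≤ K * D.nrm ((ξ : Fin M → ℝ) - ξ')) {p p' : D.Xi → ℝ}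
    (hp : p ∈ stdSimplex ℝ D.Xi) (hp' : p' ∈ stdSimplex ℝ D.Xi) :
    ∑ ξ, p ξ * f ξ - ∑ ξ, p' ξ * f ξ ≤ K * D.wasserstein p p' := by
  rw [wasserstein, ← smul_eq_mul, ← Real.sInf_smul_of_nonneg hK]
  refine le_csInf (Set.Nonempty.smul_set ⟨_, _, isCoupling_mul hp hp', rfl⟩) ?_
  rintro _ ⟨_, ⟨γ, ⟨hγ, hfst, hsnd⟩, rfl⟩, rfl⟩
  calc ∑ ξ, p ξ * f ξ - ∑ ξ', p' ξ' * f ξ'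
      = ∑ ξ, ∑ ξ', γ ξ ξ' * (f ξ - f ξ') := by
        simp only [mul_sub, Finset.sum_sub_distrib, ← hfst, Finset.sum_mul]
        rw [Finset.sum_comm (f := fun ξ ξ' => γ ξ ξ' * f ξ')]
        simp only [← hsnd, Finset.sum_mul]
    _ ≤ ∑ ξ : D.Xi, ∑ ξ' : D.Xi, γ ξ ξ' * (K * D.nrm ((ξ : Fin M → ℝ) - ξ')) := by
        gcongr with ξ _ ξ' _
        · exact hγ ξ ξ'
        · exact hf ξ ξ'
    _ = K • ∑ ξ : D.Xi, ∑ ξ' : D.Xi, D.nrm ((ξ : Fin M → ℝ) - ξ') * γ ξ ξ' := by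
        simp only [smul_eq_mul, Finset.mul_sum]
        exact Finset.sum_congr rfl fun ξ _ => Finset.sum_congr rfl fun ξ' _ => by ring

theorem stochasticValue_le_droValue {N : ℕ} (hN : N ≠ 0) {ε : ℝ} (hε : 0 ≤ ε) (s : Fin N → D.Xi) :
    D.stochasticValue (D.empirical s) ≤ D.droValue ε s := by
  have hmem := empirical_mem_stdSimplex hN s
  refine iInf₂_mono fun x _ => ?_
  rw [EReal.coe_add]
  gcongr
  exact le_iSup₂_of_le (D.empirical s) ⟨hmem, (wasserstein_self_nonpos hmem.1).trans hε⟩ le_rfl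

theorem exists_droValue_le (hx : x ∈ D.X) :
    ∃ K : ℝ, ∀ {N : ℕ} (_ : N ≠ 0) (ε : ℝ) (s : Fin N → D.Xi),
      D.droValue ε s ≤ (D.c x + K * ε + D.expectedLoss x (D.empirical s) : ℝ) := by
  obtain ⟨K, hK, hlip⟩ := exists_sub_le_mul_nrm fun ξ : D.Xi => (D.loss x ξ).toReal
  refine ⟨K, fun hN ε s => (iInf₂_le x hx).trans ?_⟩
  rw [add_assoc, EReal.coe_add]
  gcongr
  refine iSup₂_le fun p hp => EReal.coe_le_coe_iff.2 ?_
  refine sub_le_iff_le_add.1 (le_trans ?_ (mul_le_mul_of_nonneg_left hp.2 hK))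
  exact sum_mul_sub_sum_mul_le_mul_wasserstein hK hlip hp.1 (empirical_mem_stdSimplex hN s)

theorem tendsto_droValue (hA1 : D.CompleteRecourse) (hA2 : D.ExpensiveRecourse) {P : D.Xi → ℝ}
    (hP : P ∈ stdSimplex ℝ D.Xi) {ε : ℕ → ℝ} (hε : ∀ N, 0 ≤ ε N) (hε0 : Tendsto ε atTop (𝓝 0))
    {s : ∀ N, Fin N → D.Xi} (hs : Tendsto (fun N => D.empirical (s N)) atTop (𝓝 P)) :
    Tendsto (fun N => D.droValue (ε N) (s N)) atTop (𝓝 (D.stochasticValue P)) := by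
  have hpos := eventually_ne_atTop (0 : ℕ)
  refine tendsto_stochasticValue_of_le_of_le hA1 hA2 hP
    (hpos.mono fun N hN => empirical_mem_stdSimplex hN (s N)) hs hε0
    (hpos.mono fun N hN => stochasticValue_le_droValue hN (hε N) (s N)) fun x hx δ hδ => ?_
  obtain ⟨K, hK⟩ := exists_droValue_le hx
  refine ⟨K, hpos.mono fun N hN => (hK hN (ε N) (s N)).trans (EReal.coe_le_coe_iff.2 ?_)⟩
  gcongr
  exact le_add_of_nonneg_right hδ.le

/-! ### Relaxed reformulations -/

variable {V : Type*} {g : (Fin N₁ → ℝ) → V → ℝ} {τ : V → ℝ}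

/-- A family of sets `S ξ` with objective `g x` and transport cost `τ` is asymptotically exact if
points of zero transport cost attain `Q(x, ξ)` and if, for every `b > Q(x, ξ)`, a sufficiently high
transport price `α` keeps `g x - α τ` below `b` on `S ξ`. For such a family `reformValue` converges
to the true value. The second condition asks for a price for each `b`, not for one that keeps
`g x - α τ` below `Q(x, ξ)` itself: for a continuous relaxation the latter may fail to exist. -/
structure IsAsymptoticallyExact (D : TwoStageProblem N₁ N₂ L M F) (g : (Fin N₁ → ℝ) → V → ℝ)
    (τ : V → ℝ) (S : (Fin M → ℝ) → Set V) : Prop where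
  cost_nonneg : ∀ ξ ∈ D.Xi, ∀ z ∈ S ξ, 0 ≤ τ z
  exists_loss_le : ∀ x ∈ D.X, ∀ ξ ∈ D.Xi, ∃ z ∈ S ξ, τ z = 0 ∧ D.loss x ξ ≤ g x z
  exists_slope : ∀ x ∈ D.X, ∀ ξ ∈ D.Xi, ∀ b : ℝ, D.loss x ξ < b →
    ∃ α ≥ 0, ∀ z ∈ S ξ, g x z - α * τ z < b

theorem stochasticValue_le_reformValue (hA2 : D.ExpensiveRecourse) {N : ℕ} {ε : ℝ} (hε : 0 ≤ ε)
    {s : Fin N → D.Xi} {S : Fin N → Set V}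
    (h : ∀ x ∈ D.X, ∀ i, ∃ z ∈ S i, τ z = 0 ∧ D.loss x (s i) ≤ g x z) :
    D.stochasticValue (D.empirical s) ≤ D.reformValue g τ ε S := by
  refine le_iInf₂ fun x hx => le_iInf₂ fun α hα => (iInf₂_le x hx).trans ?_
  rw [expectedLoss_empirical, EReal.coe_add, EReal.coe_mul, ereal_coe_sum]
  refine add_le_add (EReal.coe_le_coe_iff.2 (le_add_of_nonneg_right (mul_nonneg hα hε)))
    (mul_le_mul_of_nonneg_left (Finset.sum_le_sum fun i _ => ?_)
      (EReal.coe_nonneg.2 (by positivity)))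
  obtain ⟨z, hz, hτ, hle⟩ := h x hx i
  rw [coe_toReal_loss hA2 hx (s i).2]
  exact le_iSup₂_of_le z hz (by simpa [hτ] using hle)

theorem reformValue_le {N : ℕ} (hN : N ≠ 0) {ε : ℝ} {s : Fin N → D.Xi} {S : Fin N → Set V}
    (hx : x ∈ D.X) {α : ℝ} (hα : 0 ≤ α) {δ : ℝ}
    (h : ∀ i, ∀ z ∈ S i, g x z - α * τ z ≤ (D.loss x (s i)).toReal + δ) :
    D.reformValue g τ ε S ≤
      (D.c x + α * ε + (D.expectedLoss x (D.empirical s) + δ) : ℝ) := by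
  have hsum : D.expectedLoss x (D.empirical s) + δ =
      (1 / (N : ℝ)) * ∑ i, ((D.loss x (s i)).toReal + δ) := by
    rw [expectedLoss_empirical, Finset.sum_add_distrib, mul_add]
    simp [hN]
  refine (iInf₂_le x hx).trans ((iInf₂_le α hα).trans ?_)
  rw [hsum, EReal.coe_add (D.c x + α * ε), EReal.coe_mul (1 / (N : ℝ)), ereal_coe_sum]
  refine add_le_add_right (mul_le_mul_of_nonneg_left (Finset.sum_le_sum fun i _ => ?_)
    (EReal.coe_nonneg.2 (by positivity))) _
  exact iSup₂_le fun z hz => EReal.coe_le_coe_iff.2 (h i z hz)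

namespace IsAsymptoticallyExact

variable {S : (Fin M → ℝ) → Set V}

theorem exists_common_slope (h : D.IsAsymptoticallyExact g τ S) (hA2 : D.ExpensiveRecourse)
    (hx : x ∈ D.X) {δ : ℝ} (hδ : 0 < δ) :
    ∃ α ≥ 0, ∀ ξ : D.Xi, ∀ z ∈ S ξ, g x z - α * τ z ≤ (D.loss x ξ).toReal + δ := by
  have hlt : ∀ ξ : D.Xi, D.loss x ξ < ((D.loss x ξ).toReal + δ : ℝ) := fun ξ => by
    conv_lhs => rw [← coe_toReal_loss hA2 hx ξ.2]
    exact EReal.coe_lt_coe_iff.2 (lt_add_of_pos_right _ hδ)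
  choose α _ hslope using fun ξ : D.Xi => h.exists_slope x hx ξ ξ.2 _ (hlt ξ)
  obtain ⟨A, hA⟩ := Finite.exists_le α
  refine ⟨max A 0, le_max_right A 0, fun ξ z hz => le_trans ?_ (hslope ξ z hz).le⟩
  have hτ := h.cost_nonneg ξ ξ.2 z hz
  gcongr
  exact (hA ξ).trans (le_max_left A 0)

theorem tendsto_reformValue (h : D.IsAsymptoticallyExact g τ S) (hA1 : D.CompleteRecourse)
    (hA2 : D.ExpensiveRecourse) {P : D.Xi → ℝ} (hP : P ∈ stdSimplex ℝ D.Xi) {ε : ℕ → ℝ}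
    (hε : ∀ N, 0 ≤ ε N) (hε0 : Tendsto ε atTop (𝓝 0)) {s : ∀ N, Fin N → D.Xi}
    (hs : Tendsto (fun N => D.empirical (s N)) atTop (𝓝 P)) :
    Tendsto (fun N => D.reformValue g τ (ε N) fun i => S (s N i)) atTop
      (𝓝 (D.stochasticValue P)) := by
  have hpos := eventually_ne_atTop (0 : ℕ)
  refine tendsto_stochasticValue_of_le_of_le hA1 hA2 hP
    (hpos.mono fun N hN => empirical_mem_stdSimplex hN (s N)) hs hε0
    (.of_forall fun N => stochasticValue_le_reformValue hA2 (hε N) fun x hx i =>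
      h.exists_loss_le x hx _ (s N i).2) fun x hx δ hδ => ?_
  obtain ⟨α, hα, hle⟩ := h.exists_common_slope hA2 hx hδ
  exact ⟨α, hpos.mono fun N hN => reformValue_le hN hx hα fun i => hle (s N i)⟩

end IsAsymptoticallyExact

end RobustAndRelaxedValues

section Linearized

variable {x : Fin N₁ → ℝ} {S : Set (Fin M → ℝ)} {ξ ξhat : Fin M → ℝ} {lam : Fin L → ℝ}

theorem isClosed_dualCone : IsClosed D.dualCone := by
  simp only [dualCone, Set.ofPred_forall]
  refine isClosed_iInter fun y => isClosed_iInter fun _ => isClosed_le continuous_const ?_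
  exact continuous_id.dotProduct continuous_const

theorem continuous_nrm : Continuous D.nrm := by
  simpa only [interior_univ, continuousOn_univ] using D.nrm.convexOn.continuousOn_interior

theorem XiRelaxed_subset_Icc : D.XiRelaxed ⊆ Set.Icc 0 1 :=
  fun _ hξ => ⟨fun j => (hξ.1 j).1, fun j => (hξ.1 j).2⟩

theorem isClosed_XiRelaxed : IsClosed D.XiRelaxed := by
  have : D.XiRelaxed = Set.Icc 0 1 ∩ (D.E *ᵥ ·) ⁻¹' Set.Iic D.f := by
    ext ξ
    simp [XiRelaxed, Pi.le_def, forall_and]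
  rw [this]
  exact isClosed_Icc.inter (isClosed_Iic.preimage (continuous_const.matrix_mulVec continuous_id))

/-! ### The linearized representation -/

theorem linearizedObjective_vecMulVec (x : Fin N₁ → ℝ) (ξ : Fin M → ℝ) (lam : Fin L → ℝ) (t : ℝ) :
    D.linearizedObjective x (ξ, lam, vecMulVec lam ξ, t) = lam ⬝ᵥ (D.T x *ᵥ ξ + D.h x) := by
  simp only [linearizedObjective, dotProduct_add, dotProduct_comm (D.h x), vecMulVec_apply]
  congr 1
  simp only [dotProduct, mulVec, Finset.mul_sum, mul_left_comm]

theorem sub_sum_transpose_mulVec_vecMulVec (ξ : Fin M → ℝ) (lam : Fin L → ℝ) :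
    D.q₀ + D.Qmat *ᵥ ξ - D.W₀ᵀ *ᵥ lam - ∑ j, (D.W j)ᵀ *ᵥ (fun l => vecMulVec lam ξ l j) =
      D.qAt ξ - (D.WAt ξ)ᵀ *ᵥ lam := by
  have hcol : ∀ j, (fun l => vecMulVec lam ξ l j) = ξ j • lam := fun j => by
    ext l
    simp [vecMulVec_apply, mul_comm]
  simp only [hcol, qAt, WAt, transpose_add, transpose_sum, transpose_smul, add_mulVec, sum_mulVec,
    smul_mulVec, mulVec_smul, sub_sub]

theorem mem_linearizedSet_vecMulVec {lamBar : Fin L → ℝ} (hξ : ξ ∈ D.Xi) (hlam : 0 ≤ lam)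
    (hbar : lam ≤ lamBar) (hdual : D.qAt ξ - (D.WAt ξ)ᵀ *ᵥ lam ∈ D.dualCone) :
    (ξ, lam, vecMulVec lam ξ, 0) ∈ D.linearizedSet D.XiRelaxed lamBar ξ := by
  have hmem := mem_XiRelaxed_of_mem_Xi hξ
  refine ⟨hmem, hlam, fun l j => mul_nonneg (hlam l) (hmem.1 j).1, le_rfl, by simp,
    fun l j => ?_, fun l j => ?_, fun l j => ?_, ?_⟩
  · have := mul_nonneg (sub_nonneg.2 (hbar l)) (sub_nonneg.2 (hmem.1 j).2)
    rw [vecMulVec_apply]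
    linarith
  · exact sub_nonneg.2 (mul_le_of_le_one_right (hlam l) (hmem.1 j).2)
  · exact sub_nonneg.2 (mul_le_mul_of_nonneg_right (hbar l) (hmem.1 j).1)
  · rwa [sub_sum_transpose_mulVec_vecMulVec]

theorem eq_vecMulVec_of_mem_linearizedSet {lamBar : Fin L → ℝ} {Lam : Matrix (Fin L) (Fin M) ℝ}
    {t : ℝ} (hz : (ξ, lam, Lam, t) ∈ D.linearizedSet S lamBar ξhat) (hξ : ξ ∈ D.Xi) :
    Lam = vecMulVec lam ξ := by
  obtain ⟨-, -, hnonneg, -, -, hlow, hle, hbar, -⟩ := hz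
  ext l j
  specialize hnonneg l j
  specialize hlow l j
  specialize hle l j
  specialize hbar l j
  rw [vecMulVec_apply]
  rcases (mem_Xi.1 hξ).1 j with h | h <;> rw [h] at hlow hbar ⊢ <;> linarith

theorem le_of_mem_linearizedSet {lamBar : Fin L → ℝ} (hbar : D.IsDualBound lamBar)
    (hξ : ξhat ∈ D.Xi) {z : (Fin M → ℝ) × (Fin L → ℝ) × Matrix (Fin L) (Fin M) ℝ × ℝ}
    (hz : z ∈ D.linearizedSet S lamBar ξhat) : z.2.1 ≤ lamBar := by
  obtain ⟨ζ, lam, Lam, t⟩ := z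
  obtain ⟨-, hlam, -, -, -, hlow, -, hle, hdual⟩ := hz
  -- Only the inequalities indexed by some `j` bound `λ`; for `M = 0` the dual feasibility does.
  rcases isEmpty_or_nonempty (Fin M) with _ | ⟨⟨j⟩⟩
  · obtain rfl : ζ = ξhat := Subsingleton.elim _ _
    obtain rfl : Lam = vecMulVec lam ζ := Subsingleton.elim _ _
    rw [sub_sum_transpose_mulVec_vecMulVec] at hdual
    exact hbar.2 ζ hξ lam hlam hdual
  · intro l
    have := add_nonneg (hlow l j) (hle l j)
    change lam l ≤ lamBar l
    linarith

theorem isClosed_linearizedSet (hS : IsClosed S) (lamBar : Fin L → ℝ) (ξhat : Fin M → ℝ) :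
    IsClosed (D.linearizedSet S lamBar ξhat) := by
  have hnrm := D.continuous_nrm
  have hall : ∀ {u : (Fin M → ℝ) × (Fin L → ℝ) × Matrix (Fin L) (Fin M) ℝ × ℝ →
      Fin L → Fin M → ℝ},
      (∀ l j, Continuous fun z => u z l j) → IsClosed {z | ∀ l j, 0 ≤ u z l j} := fun hu => by
    simp only [Set.ofPred_forall]
    exact isClosed_iInter fun l => isClosed_iInter fun j => isClosed_le continuous_const (hu l j)
  refine (hS.preimage continuous_fst).and <| (isClosed_le (by fun_prop) (by fun_prop)).and <|
    (hall fun l j => by fun_prop).and <| (isClosed_le (by fun_prop) (by fun_prop)).and <|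
    (isClosed_le (by fun_prop) (by fun_prop)).and <| (hall fun l j => by fun_prop).and <|
    (hall fun l j => by fun_prop).and <| (hall fun l j => by fun_prop).and <|
    D.isClosed_dualCone.preimage ?_
  refine ((continuous_const.add (continuous_const.matrix_mulVec continuous_fst)).sub
    (continuous_const.matrix_mulVec (by fun_prop))).sub ?_
  exact continuous_finsetSum _ fun j _ => continuous_const.matrix_mulVec (by fun_prop)

theorem exists_linearizedSet_slope {lamBar : Fin L → ℝ} (hbar : D.IsDualBound lamBar)
    (hξ : ξ ∈ D.Xi) {b : ℝ} (hb : D.loss x ξ < b) :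
    ∃ α ≥ 0, ∀ z ∈ D.linearizedSet D.XiRelaxed lamBar ξ,
      D.linearizedObjective x z - α * z.2.2.2 < b := by
  let φ : (Fin M → ℝ) × (Fin L → ℝ) × (Fin L → Fin M → ℝ) →
      (Fin M → ℝ) × (Fin L → ℝ) × Matrix (Fin L) (Fin M) ℝ × ℝ :=
    fun w => (w.1, w.2.1, .of w.2.2, D.nrm (w.1 - ξ))
  have hφ : Continuous φ := by
    have := D.continuous_nrm
    fun_prop
  have hg : Continuous (D.linearizedObjective x) := by
    unfold linearizedObjective dotProduct
    fun_prop
  have hK : IsCompact ((Set.Icc 0 1 ×ˢ Set.Icc 0 lamBar ×ˢ Set.Icc 0 fun l _ => lamBar l) ∩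
      φ ⁻¹' D.linearizedSet D.XiRelaxed lamBar ξ) :=
    (isCompact_Icc.prod (isCompact_Icc.prod isCompact_Icc)).inter_right
      ((isClosed_linearizedSet isClosed_XiRelaxed lamBar ξ).preimage hφ)
  refine exists_penalty_slope_of_dominated (d := fun w => D.nrm (w.1 - ξ)) hK (hg.comp hφ)
    (by have := D.continuous_nrm; fun_prop) (fun _ => apply_nonneg _ _) ?_ ?_
  · rintro ⟨ζ, lam, Lam, t⟩ hz
    have hlam := le_of_mem_linearizedSet hbar hξ hz
    obtain ⟨hζ, hlam0, hLam0, -, hnrm, hlow, hle, hup, hdual⟩ := hz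
    have hLam : ∀ l j, Lam l j ≤ lamBar l := fun l j => (sub_nonneg.1 (hle l j)).trans (hlam l)
    exact ⟨(ζ, lam, Lam), ⟨⟨XiRelaxed_subset_Icc hζ, ⟨hlam0, hlam⟩, hLam0, hLam⟩,
      hζ, hlam0, hLam0, apply_nonneg _ _, le_rfl, hlow, hle, hup, hdual⟩, le_rfl, hnrm⟩
  · rintro ⟨ζ, lam, Lam⟩ ⟨-, hz⟩ hd
    obtain rfl : ζ = ξ := sub_eq_zero.1 (D.nrm_definite _ hd)
    have hLam := eq_vecMulVec_of_mem_linearizedSet hz hξ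
    obtain ⟨-, hlam, -, -, -, -, -, -, hdual⟩ := hz
    change D.linearizedObjective x (ζ, lam, .of Lam, _) < b
    rw [hLam, sub_sum_transpose_mulVec_vecMulVec] at hdual
    rw [hLam, linearizedObjective_vecMulVec, ← EReal.coe_lt_coe_iff]
    exact (dual_le_loss hlam hdual).trans_lt hb

theorem isAsymptoticallyExact_linearized (hA1 : D.CompleteRecourse) (hA2 : D.ExpensiveRecourse)
    {lamBar : Fin L → ℝ} (hbar : D.IsDualBound lamBar) :
    D.IsAsymptoticallyExact D.linearizedObjective (fun z => z.2.2.2)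
      (D.linearizedSet D.XiRelaxed lamBar) where
  cost_nonneg _ _ _ hz := hz.2.2.2.1
  exists_loss_le x hx ξ hξ := by
    obtain ⟨lam, hlam, hdual, hle⟩ := exists_dual_optimal hA1 hA2 hx hξ
    refine ⟨_, mem_linearizedSet_vecMulVec hξ hlam (hbar.2 ξ hξ lam hlam hdual) hdual, rfl, ?_⟩
    rwa [linearizedObjective_vecMulVec, ← coe_toReal_loss hA2 hx hξ, EReal.coe_le_coe_iff]
  exists_slope _ _ _ hξ _ hb := exists_linearizedSet_slope hbar hξ hb

end Linearized

section Penalty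

variable {x : Fin N₁ → ℝ} {S : Set (Fin M → ℝ)} {ξ ξhat : Fin M → ℝ} {lam : Fin L → ℝ}
  {mu : Fin M → ℝ} {T₀ : Matrix (Fin L) (Fin M) ℝ} {ρ : ℝ}

/-! ### The penalty representation -/

theorem FixedRecourse.exists_pos (hfix : D.FixedRecourse T₀) (hA1 : D.CompleteRecourse)
    (hξ : ξ ∈ D.Xi) : ∃ y ∈ D.Y, ∀ l, 0 < (D.W₀ *ᵥ y) l := by
  simpa only [hfix.1 ξ hξ] using hA1.exists_pos hξ

/-- The coefficient vector `ρ (e - 2 ξ) + T₀ᵀ λ` of `ζ` in the Lagrangian of the penalized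
second-stage problem. The penalty representation asks that `μ ≥ 0` make it nonnegative, so its
negative part is the smallest admissible `μ`. -/
def penaltyReducedCost (T₀ : Matrix (Fin L) (Fin M) ℝ) (ρ : ℝ) (ξ : Fin M → ℝ)
    (lam : Fin L → ℝ) : Fin M → ℝ :=
  fun j => ρ * (1 - 2 * ξ j) + (T₀ᵀ *ᵥ lam) j

theorem penalty_add_dotProduct_eq (T₀ : Matrix (Fin L) (Fin M) ℝ) (ρ : ℝ) (ξ ζ : Fin M → ℝ)
    (lam h : Fin L → ℝ) :
    ρ * (∑ j, (1 - 2 * ξ j) * ζ j + ∑ j, ξ j) + lam ⬝ᵥ (T₀ *ᵥ ζ + h) =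
      h ⬝ᵥ lam + ρ * ∑ j, ξ j + penaltyReducedCost T₀ ρ ξ lam ⬝ᵥ ζ := by
  have hcost : penaltyReducedCost T₀ ρ ξ lam ⬝ᵥ ζ =
      ρ * ∑ j, (1 - 2 * ξ j) * ζ j + lam ⬝ᵥ T₀ *ᵥ ζ := by
    rw [dotProduct_mulVec, ← mulVec_transpose]
    simp only [penaltyReducedCost, dotProduct, add_mul, mul_assoc, Finset.sum_add_distrib,
      Finset.mul_sum]
  rw [hcost, dotProduct_add, dotProduct_comm h]
  ring

theorem penalty_self_eq_zero (hξ : ξ ∈ D.Xi) :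
    ρ * (∑ j, (1 - 2 * ξ j) * ξ j + ∑ j, ξ j) = 0 := by
  rw [← Finset.sum_add_distrib, Finset.sum_eq_zero, mul_zero]
  intro j _
  rcases (mem_Xi.1 hξ).1 j with h | h <;> rw [h] <;> norm_num

theorem penaltyObjective_le_penaltyLoss {t : ℝ}
    (hz : (ξ, lam, mu, t) ∈ D.penaltySet S T₀ ρ ξhat) :
    (D.penaltyObjective ρ x (ξ, lam, mu, t) : EReal) ≤ D.penaltyLoss T₀ ρ x ξ := by
  obtain ⟨-, hlam, hmu, -, -, hdual, hbox⟩ := hz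
  refine le_iInf₂ fun ⟨y, ζ⟩ ⟨hy, hζ, hfeas⟩ => EReal.coe_le_coe_iff.2 ?_
  have hrec := (dotProduct_le_dotProduct_of_nonneg_left hfeas hlam).trans
    (sub_mem_dualCone_iff.1 hdual y hy)
  have hpen := neg_sum_le_dotProduct_of_mem_Icc (a := penaltyReducedCost T₀ ρ ξ lam)
    ⟨fun j => (hζ j).1, fun j => (hζ j).2⟩ hmu hbox
  have hlag := penalty_add_dotProduct_eq T₀ ρ ξ ζ lam (D.h x)
  simp only [penaltyObjective, qAt] at hrec ⊢
  linarith

theorem mem_penaltySet_negPart (hξ : ξ ∈ D.Xi) (hlam : 0 ≤ lam)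
    (hdual : D.qAt ξ - D.W₀ᵀ *ᵥ lam ∈ D.dualCone) :
    (ξ, lam, (penaltyReducedCost T₀ ρ ξ lam)⁻, 0) ∈ D.penaltySet D.XiRelaxed T₀ ρ ξ :=
  ⟨mem_XiRelaxed_of_mem_Xi hξ, hlam, negPart_nonneg _, le_rfl, by simp, hdual, fun j =>
    neg_le_iff_add_nonneg'.1 (neg_le_negPart (penaltyReducedCost T₀ ρ ξ lam) j)⟩

theorem penaltyLoss_le_loss (hfix : D.FixedRecourse T₀) (ρ : ℝ) (hx : x ∈ D.X) (hξ : ξ ∈ D.Xi) :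
    D.penaltyLoss T₀ ρ x ξ ≤ D.loss x ξ := by
  refine le_iInf₂ fun y ⟨hy, hfeas⟩ => ?_
  rw [hfix.1 ξ hξ, hfix.2 x hx] at hfeas
  refine (iInf₂_le (y, ξ) ⟨hy, (mem_XiRelaxed_of_mem_Xi hξ).1, hfeas⟩).trans_eq ?_
  rw [penalty_self_eq_zero hξ, add_zero]

theorem penaltyObjective_negPart_eq (hξ : ξ ∈ D.Xi) (hρ : ∀ j, |(T₀ᵀ *ᵥ lam) j| ≤ ρ) (t : ℝ) :
    D.penaltyObjective ρ x (ξ, lam, (penaltyReducedCost T₀ ρ ξ lam)⁻, t) =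
      lam ⬝ᵥ (T₀ *ᵥ ξ + D.h x) := by
  have hneg : penaltyReducedCost T₀ ρ ξ lam ⬝ᵥ ξ = -∑ j, (penaltyReducedCost T₀ ρ ξ lam)⁻ j := by
    refine dotProduct_eq_neg_sum_negPart (fun j hj => ?_) fun j hj => ?_ <;>
    · have := abs_le.1 (hρ j)
      rcases (mem_Xi.1 hξ).1 j with h | h
      all_goals
        simp only [penaltyReducedCost, h] at hj ⊢
        try linarith
  have hlag := penalty_add_dotProduct_eq T₀ ρ ξ ξ lam (D.h x)
  rw [penalty_self_eq_zero hξ, zero_add, hneg] at hlag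
  exact hlag.symm

theorem exists_isExactPenalty (hA1 : D.CompleteRecourse) (hA2 : D.ExpensiveRecourse)
    (hfix : D.FixedRecourse T₀) : ∃ ρ₀ > 0, ∀ ρ ≥ ρ₀, D.IsExactPenalty T₀ ρ := by
  obtain ⟨lamBar, hbar⟩ := exists_isDualBound hA1
  obtain ⟨C, hC⟩ := (isCompact_Icc (a := 0) (b := lamBar)).exists_bound_of_continuousOn
    (f := (T₀ᵀ *ᵥ ·)) (continuous_const.matrix_mulVec continuous_id).continuousOn
  refine ⟨max C 1, by positivity, fun ρ hρ x hx ξ hξ =>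
    (penaltyLoss_le_loss hfix ρ hx hξ).antisymm ?_⟩
  obtain ⟨lam, hlam, hdual, hle⟩ := exists_dual_optimal hA1 hA2 hx hξ
  have hT : ∀ j, |(T₀ᵀ *ᵥ lam) j| ≤ ρ := fun j =>
    (norm_le_pi_norm _ j).trans <| (hC lam ⟨hlam, hbar.2 ξ hξ lam hlam hdual⟩).trans <|
      (le_max_left C 1).trans hρ
  rw [hfix.1 ξ hξ] at hdual
  rw [hfix.2 x hx, ← penaltyObjective_negPart_eq hξ hT 0, ← EReal.coe_le_coe_iff,
    coe_toReal_loss hA2 hx hξ] at hle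
  exact hle.trans (penaltyObjective_le_penaltyLoss (mem_penaltySet_negPart hξ hlam hdual))

theorem exists_penalty_dual_optimal (hA1 : D.CompleteRecourse) (hA2 : D.ExpensiveRecourse)
    (hfix : D.FixedRecourse T₀) (hρ : D.IsExactPenalty T₀ ρ) (hx : x ∈ D.X) (hξ : ξ ∈ D.Xi) :
    ∃ z ∈ D.penaltySet D.XiRelaxed T₀ ρ ξ, z.2.2.2 = 0 ∧
      D.loss x ξ ≤ D.penaltyObjective ρ x z := by
  have hbox : Convex ℝ (Set.Icc (0 : Fin M → ℝ) 1) := convex_Icc 0 1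
  have hψ : ConvexOn ℝ (Set.Icc 0 1) fun ζ : Fin M → ℝ =>
      ρ * (∑ j, (1 - 2 * ξ j) * ζ j + ∑ j, ξ j) :=
    (((dotProductEquiv ℝ _ (ρ • (1 - 2 * ξ))).convexOn hbox).add_const (ρ * ∑ j, ξ j)).congr
      fun ζ _ => by simp only [mul_add, Finset.mul_sum, ← mul_assoc]; rfl
  obtain ⟨lam, hlam, hdual, hval⟩ := exists_conic_dual_solution (Y := D.Y.toPointedCone)
    (A := D.W₀.mulVecLin) (q := dotProductEquiv ℝ _ (D.qAt ξ)) hψ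
    ((T₀.mulVecLin.convexOn hbox).add_const (D.h x)) (v := (D.loss x ξ).toReal)
    (fun y hy ζ hζ hle => by
      rw [← EReal.coe_le_coe_iff, coe_toReal_loss hA2 hx hξ, ← hρ x hx ξ hξ]
      exact iInf₂_le (y, ζ) ⟨hy, fun j => ⟨hζ.1 j, hζ.2 j⟩, hle⟩)
    ⟨0, le_rfl, zero_le_one⟩ (hfix.exists_pos hA1 hξ)
  obtain ⟨ζ, hζ, hζneg⟩ := exists_dotProduct_eq_neg_sum_negPart (penaltyReducedCost T₀ ρ ξ lam)
  refine ⟨_, mem_penaltySet_negPart hξ hlam (sub_mem_dualCone_iff.2 hdual), rfl, ?_⟩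
  rw [← coe_toReal_loss hA2 hx hξ, EReal.coe_le_coe_iff]
  exact (hval ζ hζ).trans_eq ((penalty_add_dotProduct_eq T₀ ρ ξ ζ lam (D.h x)).trans
    (by rw [hζneg]; rfl))

theorem continuous_qAt : Continuous D.qAt :=
  continuous_const.add (continuous_const.matrix_mulVec continuous_id)

theorem continuous_negPart_penaltyReducedCost (T₀ : Matrix (Fin L) (Fin M) ℝ) (ρ : ℝ) :
    Continuous fun w : (Fin M → ℝ) × (Fin L → ℝ) => (penaltyReducedCost T₀ ρ w.1 w.2)⁻ := by
  refine continuous_pi fun j => ?_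
  simp only [Pi.negPart_apply, negPart_def, penaltyReducedCost, mulVec, dotProduct]
  fun_prop

theorem isClosed_penaltySet (hS : IsClosed S) (T₀ : Matrix (Fin L) (Fin M) ℝ) (ρ : ℝ)
    (ξhat : Fin M → ℝ) : IsClosed (D.penaltySet S T₀ ρ ξhat) := by
  have hnrm := D.continuous_nrm
  refine (hS.preimage continuous_fst).and <| (isClosed_le (by fun_prop) (by fun_prop)).and <|
    (isClosed_le (by fun_prop) (by fun_prop)).and <|
    (isClosed_le (by fun_prop) (by fun_prop)).and <|
    (isClosed_le (by fun_prop) (by fun_prop)).and <| (D.isClosed_dualCone.preimage ?_).and ?_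
  · exact (D.continuous_qAt.comp continuous_fst).sub (continuous_const.matrix_mulVec (by fun_prop))
  · simp only [Set.ofPred_forall]
    refine isClosed_iInter fun j => isClosed_le continuous_const ?_
    unfold mulVec dotProduct
    fun_prop

theorem exists_le_of_mem_penaltySet (hpos : ∃ y ∈ D.Y, ∀ l, 0 < (D.W₀ *ᵥ y) l)
    (T₀ : Matrix (Fin L) (Fin M) ℝ) (ρ : ℝ) (ξhat : Fin M → ℝ) :
    ∃ lamBar, ∀ z ∈ D.penaltySet D.XiRelaxed T₀ ρ ξhat, z.2.1 ≤ lamBar := by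
  obtain ⟨y, hy, hpos⟩ := hpos
  obtain ⟨R, hR⟩ := (isCompact_Icc (a := (0 : Fin M → ℝ)) (b := 1)).bddAbove_image
    (f := fun ζ => D.qAt ζ ⬝ᵥ y) (D.continuous_qAt.dotProduct continuous_const).continuousOn
  refine ⟨fun l => R / (D.W₀ *ᵥ y) l, ?_⟩
  rintro ⟨ζ, lam, mu, t⟩ ⟨hζ, hlam, -, -, -, hdual, -⟩ l
  refine (le_div_of_forall_dotProduct_le (Y := D.Y.toPointedCone) (A := D.W₀.mulVecLin)
    (q := dotProductEquiv ℝ _ (D.qAt ζ)) hlam (sub_mem_dualCone_iff.1 hdual) hy hpos l).trans ?_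
  exact div_le_div_of_nonneg_right (hR ⟨ζ, XiRelaxed_subset_Icc hζ, rfl⟩) (hpos l).le

theorem exists_penaltySet_slope (hA1 : D.CompleteRecourse)
    (hfix : D.FixedRecourse T₀) (hρ : D.IsExactPenalty T₀ ρ) (hx : x ∈ D.X) (hξ : ξ ∈ D.Xi)
    {b : ℝ} (hb : D.loss x ξ < b) :
    ∃ α ≥ 0, ∀ z ∈ D.penaltySet D.XiRelaxed T₀ ρ ξ,
      D.penaltyObjective ρ x z - α * z.2.2.2 < b := by
  obtain ⟨lamBar, hbar⟩ := exists_le_of_mem_penaltySet (hfix.exists_pos hA1 hξ) T₀ ρ ξ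
  let φ : (Fin M → ℝ) × (Fin L → ℝ) → (Fin M → ℝ) × (Fin L → ℝ) × (Fin M → ℝ) × ℝ :=
    fun w => (w.1, w.2, (penaltyReducedCost T₀ ρ w.1 w.2)⁻, D.nrm (w.1 - ξ))
  have hφ : Continuous φ := by
    have hnrm := D.continuous_nrm
    have hneg := continuous_negPart_penaltyReducedCost T₀ ρ
    fun_prop
  have hg : Continuous (D.penaltyObjective ρ x) := by
    unfold penaltyObjective dotProduct
    fun_prop
  have hK : IsCompact ((Set.Icc 0 1 ×ˢ Set.Icc 0 lamBar) ∩
      φ ⁻¹' D.penaltySet D.XiRelaxed T₀ ρ ξ) :=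
    (isCompact_Icc.prod isCompact_Icc).inter_right
      ((isClosed_penaltySet isClosed_XiRelaxed T₀ ρ ξ).preimage hφ)
  refine exists_penalty_slope_of_dominated (d := fun w => D.nrm (w.1 - ξ)) hK (hg.comp hφ)
    (by have := D.continuous_nrm; fun_prop) (fun _ => apply_nonneg _ _) ?_ ?_
  · rintro ⟨ζ, lam, mu, t⟩ hz
    have hlam := hbar _ hz
    obtain ⟨hζ, hlam0, hmu, -, hnrm, hdual, hbox⟩ := hz
    have hle : (penaltyReducedCost T₀ ρ ζ lam)⁻ ≤ mu :=
      sup_le (fun j => neg_le_iff_add_nonneg'.2 (hbox j)) hmu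
    refine ⟨(ζ, lam), ⟨⟨XiRelaxed_subset_Icc hζ, hlam0, hlam⟩, hζ, hlam0, negPart_nonneg _,
      apply_nonneg _ _, le_rfl, hdual, fun j => ?_⟩, ?_, hnrm⟩
    · exact neg_le_iff_add_nonneg'.1 (neg_le_negPart (penaltyReducedCost T₀ ρ ζ lam) j)
    · exact sub_le_sub_left (Finset.sum_le_sum fun j _ => hle j) _
  · rintro ⟨ζ, lam⟩ ⟨-, hz⟩ hd
    obtain rfl : ζ = ξ := sub_eq_zero.1 (D.nrm_definite _ hd)
    rw [← hρ x hx ζ hξ] at hb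
    exact EReal.coe_lt_coe_iff.1 ((penaltyObjective_le_penaltyLoss hz).trans_lt hb)

theorem isAsymptoticallyExact_penalty (hA1 : D.CompleteRecourse) (hA2 : D.ExpensiveRecourse)
    (hfix : D.FixedRecourse T₀) (hρ : D.IsExactPenalty T₀ ρ) :
    D.IsAsymptoticallyExact (D.penaltyObjective ρ) (fun z => z.2.2.2)
      (D.penaltySet D.XiRelaxed T₀ ρ) where
  cost_nonneg _ _ _ hz := hz.2.2.2.1
  exists_loss_le _ hx _ hξ := exists_penalty_dual_optimal hA1 hA2 hfix hρ hx hξ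
  exists_slope _ hx _ hξ _ hb := exists_penaltySet_slope hA1 hfix hρ hx hξ hb

end Penalty

/-! ### Almost sure convergence -/

theorem mem_stdSimplex_of_law {P : D.Xi → ℝ} {Ω : Type*} [MeasurableSpace Ω] {μ : Measure Ω}
    [IsProbabilityMeasure μ] {X : Ω → D.Xi} (hmeas : Measurable X)
    (hlaw : ∀ ξ, μ.real (X ⁻¹' {ξ}) = P ξ) : P ∈ stdSimplex ℝ D.Xi := by
  refine ⟨fun ξ => hlaw ξ ▸ measureReal_nonneg, ?_⟩
  simp only [← hlaw]
  rw [sum_measureReal_preimage_singleton _ fun ξ _ => hmeas (measurableSet_singleton ξ)]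
  simp

theorem empirical_apply_eq_sum_indicator_div (X : ℕ → D.Xi) (N : ℕ) (ξ : D.Xi) :
    D.empirical (fun i : Fin N => X i) ξ =
      (∑ i ∈ Finset.range N, ({ξ} : Set D.Xi).indicator 1 (X i)) / (N : ℝ) := by
  rw [empirical, one_div_mul_eq_div,
    ← Fin.sum_univ_eq_sum_range fun i => ({ξ} : Set D.Xi).indicator (1 : D.Xi → ℝ) (X i)]
  simp only [Set.indicator_apply, Set.mem_singleton_iff, Pi.one_apply]

theorem ae_tendsto_empirical {P : D.Xi → ℝ} {Ω : Type*} [MeasurableSpace Ω] {μ : Measure Ω}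
    [IsFiniteMeasure μ] {ξhat : ℕ → Ω → D.Xi} (hmeas : ∀ i, Measurable (ξhat i))
    (hindep : Pairwise fun i j => ξhat i ⟂ᵢ[μ] ξhat j)
    (hlaw : ∀ i ξ, μ.real (ξhat i ⁻¹' {ξ}) = P ξ) :
    ∀ᵐ ω ∂μ, Tendsto (fun N : ℕ => D.empirical fun i : Fin N => ξhat i ω) atTop (𝓝 P) := by
  have hident : ∀ i, IdentDistrib (ξhat i) (ξhat 0) μ μ := fun i =>
    ⟨(hmeas i).aemeasurable, (hmeas 0).aemeasurable, Measure.ext_iff_singleton.2 fun ξ => by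
      rw [Measure.map_apply (hmeas i) (measurableSet_singleton ξ),
        Measure.map_apply (hmeas 0) (measurableSet_singleton ξ)]
      exact (measureReal_eq_measureReal_iff).1 ((hlaw i ξ).trans (hlaw 0 ξ).symm)⟩
  filter_upwards [ae_all_iff.2 fun ξ : D.Xi =>
    ae_tendsto_frequency hindep hident (measurableSet_singleton ξ)] with ω hω
  refine tendsto_pi_nhds.2 fun ξ => ?_
  simpa only [empirical_apply_eq_sum_indicator_div (ξhat · ω), hlaw] using hω ξ

end TwoStageProblem

open TwoStageProblem in
theorem mainTheorem4_general {N₁ N₂ L M F : ℕ} (D : TwoStageProblem N₁ N₂ L M F)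
    (hA1 : D.CompleteRecourse) (hA2 : D.ExpensiveRecourse) (P : D.Xi → ℝ)
    {Ω : Type*} [MeasurableSpace Ω] (μ : Measure Ω) [IsProbabilityMeasure μ]
    (ξhat : ℕ → Ω → D.Xi) (hmeas : ∀ i, Measurable (ξhat i))
    (hindep : Pairwise fun i j => ξhat i ⟂ᵢ[μ] ξhat j)
    (hlaw : ∀ i ξ, μ.real (ξhat i ⁻¹' {ξ}) = P ξ)
    (ε : ℕ → ℝ) (hε0 : ∀ N, 0 ≤ ε N) (hε : Tendsto ε atTop (𝓝 0)) :
    ∃ v : ℝ, D.stochasticValue P = (v : EReal) ∧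
      (∀ᵐ ω ∂μ, Tendsto (fun N : ℕ => D.droValue (ε N) (fun i : Fin N => ξhat i ω))
        atTop (𝓝 (v : EReal))) ∧
      ((∃ lamBar, D.IsDualBound lamBar) ∧
        ∀ lamBar, D.IsDualBound lamBar →
          ∀ᵐ ω ∂μ, Tendsto (fun N : ℕ =>
              D.linearizedRelaxedValue lamBar (ε N) (fun i : Fin N => ξhat i ω))
            atTop (𝓝 (v : EReal))) ∧
      (∀ T₀, D.FixedRecourse T₀ →
        (∃ ρ₀ > 0, ∀ ρ ≥ ρ₀, D.IsExactPenalty T₀ ρ) ∧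
        ∀ ρ, D.IsExactPenalty T₀ ρ →
          ∀ᵐ ω ∂μ, Tendsto (fun N : ℕ =>
              D.penaltyRelaxedValue T₀ ρ (ε N) (fun i : Fin N => ξhat i ω))
            atTop (𝓝 (v : EReal))) := by
  have hP := mem_stdSimplex_of_law (hmeas 0) (hlaw 0)
  have hemp := ae_tendsto_empirical hmeas hindep hlaw
  obtain ⟨v, hv⟩ := exists_stochasticValue_eq_coe hA1 hA2 hP
  refine ⟨v, hv, ?_, ⟨exists_isDualBound hA1, fun lamBar hbar => ?_⟩,
    fun T₀ hfix => ⟨exists_isExactPenalty hA1 hA2 hfix, fun ρ hρ => ?_⟩⟩ <;>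
  rw [← hv] <;>
  filter_upwards [hemp] with ω hω
  · exact tendsto_droValue hA1 hA2 hP hε0 hε hω
  · exact (isAsymptoticallyExact_linearized hA1 hA2 hbar).tendsto_reformValue hA1 hA2 hP hε0 hε hω
  · exact (isAsymptoticallyExact_penalty hA1 hA2 hfix hρ).tendsto_reformValue hA1 hA2 hP hε0 hε hω

theorem mainTheorem4 {N₁ N₂ L M F : ℕ} (D : TwoStageProblem N₁ N₂ L M F)
    (hA1 : D.CompleteRecourse) (hA2 : D.ExpensiveRecourse)
    -- the true distribution and an i.i.d. sample from it
    (P : D.Xi → ℝ) (hP : P ∈ stdSimplex ℝ D.Xi)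
    {Ω : Type*} [MeasurableSpace Ω] (μ : Measure Ω) [IsProbabilityMeasure μ]
    (ξhat : ℕ → Ω → D.Xi) (hmeas : ∀ i, Measurable (ξhat i)) (hindep : iIndepFun ξhat μ)
    (hlaw : ∀ i ξ, μ.real (ξhat i ⁻¹' {ξ}) = P ξ)
    -- the radii
    (ε : ℕ → ℝ) (hε0 : ∀ N, 0 ≤ ε N) (hε : Tendsto (fun N : ℕ => (N : ℝ) * ε N) atTop (𝓝 0)) :
    ∃ v : ℝ, D.stochasticValue P = (v : EReal) ∧
      (∀ᵐ ω ∂μ, Tendsto (fun N : ℕ => D.droValue (ε N) (fun i : Fin N => ξhat i ω))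
        atTop (𝓝 (v : EReal))) ∧
      -- linearized representation
      ((∃ lamBar, D.IsDualBound lamBar) ∧
        ∀ lamBar, D.IsDualBound lamBar →
          ∀ᵐ ω ∂μ, Tendsto (fun N : ℕ =>
              D.linearizedRelaxedValue lamBar (ε N) (fun i : Fin N => ξhat i ω))
            atTop (𝓝 (v : EReal))) ∧
      -- penalty representation
      (∀ T₀, D.FixedRecourse T₀ →
        (∃ ρ₀ > 0, ∀ ρ ≥ ρ₀, D.IsExactPenalty T₀ ρ) ∧
        ∀ ρ > 0, D.IsExactPenalty T₀ ρ →
          ∀ᵐ ω ∂μ, Tendsto (fun N : ℕ =>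
              D.penaltyRelaxedValue T₀ ρ (ε N) (fun i : Fin N => ξhat i ω))
            atTop (𝓝 (v : EReal))) := by
  obtain ⟨v, hv, hdro, hlin, hpen⟩ := mainTheorem4_general D hA1 hA2 P μ ξhat hmeas
    (fun _ _ hij => hindep.indepFun hij) hlaw ε hε0 (tendsto_zero_of_natCast_mul hε)
  exact ⟨v, hv, hdro, hlin, fun T₀ hfix => (hpen T₀ hfix).imp_right fun h ρ _ => h ρ⟩
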